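/- Let $p$ be an odd prime. Write $[x,y]=x^{-1}y^{-1}xy$. Let $\mathbb H_3(R)$ denote the Heisenberg group over a ring $R$, that is, the set $R\times R\times R$ with multiplication $(c,b,a)(c',b',a')=(c+c'+ab',\,b+b',\,a+a')$. A representation group of a finite group $G$ is a group $G^\star$ with a central extension $1\to A\to G^\star\to G\to 1$ such that $A\subseteq Z(G^\star)\cap [G^\star,G^\star]$ and $A\cong \mathrm H^2(G,\mathbb C^\times)$ (trivial action). In the presentations below, the letters $z_i,t_j$ abbreviate the indicated words in the generators, and every commutator of two of the displayed letters (generators, $z_i$, $t_j$) that is not explicitly given is trivial. In particular, all $t_j$ are central. Let $$G^\star=\langle x_1,x_2,y_1,y_2 \mid [x_1,x_2]=z_1,\ [y_1,y_2]=z_2,\ [z_1,x_1]=t_1,\ [z_1,x_2]=t_2,\ [z_2,y_1]=t_3,\ [z_2,y_2]=t_4,$$ $$[x_1,y_1]=t_5,\ [x_1,y_2]=t_6,\ [x_2,y_1]=t_7,\ [x_2,y_2]=t_8,\ x_i^p=y_i^p=z_i^p=1\ (i=1,2)\rangle,$$ $$H'=\langle x_1,x_2\mid [x_1,x_2]=z_1,\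 [z_1,x_1]=t_1,\ [z_1,x_2]=t_2,\ x_1^p=x_2^p=z_1^p=1\rangle,$$ $$K'=\langle y_1,y_2\mid [y_1,y_2]=z_2,\ [z_2,y_1]=t_3,\ [z_2,y_2]=t_4,\ y_1^p=y_2^p=z_2^p=1\rangle .$$ Then: 1. $G^\star$ has order $p^{14}$ and is nilpotent of class exactly $3$. 2. $G^\star$ is a representation group of $\mathbb H_3(\mathbb Z/p\mathbb Z\times\mathbb Z/p\mathbb Z)$. 3. $H'\cong K'$, and both have order $p^5$. 4. For some action of $K'$ on $H'\times(\mathbb Z/p\mathbb Z)^4$ by automorphisms there is an isomorphism $G^\star\cong\big(H'\times(\mathbb Z/p\mathbb Z)^4\big)\rtimes K'$ that sends $x_1,x_2$ to the generators of $H'$, sends $t_5,t_6,t_7,t_8$ to the standard basis of $(\mathbb Z/p\mathbb Z)^4$, and sends $y_1,y_2$ to the generators of $K'$. -/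

import Mathlib

/-- The three-dimensional discrete Heisenberg group `H₃(R)`: the set `R × R × R` of triples
`(c, b, a)`, with multiplication `(c, b, a) (c', b', a') = (c + c' + a b', b + b', a + a')`. -/
@[ext]
structure HeisenbergGroup (R : Type) where
  c : R
  b : R
  a : R

namespace HeisenbergGroup

variable {R : Type} [Ring R]

instance : Mul (HeisenbergGroup R) :=
  ⟨fun g h => ⟨g.c + h.c + g.a * h.b, g.b + h.b, g.a + h.a⟩⟩

instance : One (HeisenbergGroup R) := ⟨⟨0, 0, 0⟩⟩

instance : Inv (HeisenbergGroup R) := ⟨fun g => ⟨-g.c + g.a * g.b, -g.b, -g.a⟩⟩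

@[simp] theorem mul_c (g h : HeisenbergGroup R) : (g * h).c = g.c + h.c + g.a * h.b := rfl
@[simp] theorem mul_b (g h : HeisenbergGroup R) : (g * h).b = g.b + h.b := rfl
@[simp] theorem mul_a (g h : HeisenbergGroup R) : (g * h).a = g.a + h.a := rfl
@[simp] theorem one_c : (1 : HeisenbergGroup R).c = 0 := rfl
@[simp] theorem one_b : (1 : HeisenbergGroup R).b = 0 := rfl
@[simp] theorem one_a : (1 : HeisenbergGroup R).a = 0 := rfl
@[simp] theorem inv_c (g : HeisenbergGroup R) : (g⁻¹).c = -g.c + g.a * g.b := rfl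
@[simp] theorem inv_b (g : HeisenbergGroup R) : (g⁻¹).b = -g.b := rfl
@[simp] theorem inv_a (g : HeisenbergGroup R) : (g⁻¹).a = -g.a := rfl

instance : Group (HeisenbergGroup R) :=
  Group.ofLeftAxioms
    (fun g h k => by
      ext
      · simp only [mul_c, mul_b, mul_a, mul_add, add_mul]; abel
      · simp only [mul_b]; abel
      · simp only [mul_a]; abel)
    (fun g => by ext <;> simp)
    (fun g => by ext <;> simp)

end HeisenbergGroup

/-- The Schur multiplier `H²(G, ℂˣ)`, for the trivial action of `G` on `ℂˣ`. -/
noncomputable abbrev SchurMultiplier (G : Type) [Group G] : Type :=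
  groupCohomology.H2 (Rep.trivial ℤ G (Additive ℂˣ))

/-- `S` is a representation group of the finite group `G`: there is a stem extension
`1 → A → S → G → 1` (that is, `A` lies in `Z(S) ∩ S'`) with `A ≅ H²(G, ℂˣ)`. -/
def IsRepresentationGroup (G S : Type) [Group G] [Group S] : Prop :=
  ∃ π : S →* G, Function.Surjective π ∧
    π.ker ≤ Subgroup.center S ⊓ commutator S ∧
    Nonempty (Additive π.ker ≃+ SchurMultiplier G)

/-- The commutator, in the convention `[x, y] = x⁻¹ y⁻¹ x y`. -/
def rcomm {G : Type} [Group G] (x y : G) : G := x⁻¹ * y⁻¹ * x * y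

namespace RepGroup

/-- The generators `x₁, x₂, y₁, y₂`. -/
inductive Gen
  | x1 | x2 | y1 | y2

def x1 : FreeGroup Gen := FreeGroup.of Gen.x1
def x2 : FreeGroup Gen := FreeGroup.of Gen.x2
def y1 : FreeGroup Gen := FreeGroup.of Gen.y1
def y2 : FreeGroup Gen := FreeGroup.of Gen.y2

/-- `z₁ = [x₁, x₂]`. -/
def z1 : FreeGroup Gen := rcomm x1 x2

/-- `z₂ = [y₁, y₂]`. -/
def z2 : FreeGroup Gen := rcomm y1 y2

/-- The words `t₁, …, t₈` (indexed from `0`). -/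
def t : Fin 8 → FreeGroup Gen :=
  ![rcomm z1 x1, rcomm z1 x2, rcomm z2 y1, rcomm z2 y2,
    rcomm x1 y1, rcomm x1 y2, rcomm x2 y1, rcomm x2 y2]

/-- The relators of `G⋆`: the `p`-th powers of `xᵢ, yᵢ, zᵢ`, and the commutators of those pairs
among `x₁, x₂, y₁, y₂, z₁, z₂, t₁, …, t₈` whose commutator is not one of `z₁, z₂, t₁, …, t₈`. -/
def relators (p : ℕ) : Set (FreeGroup Gen) :=
  {x1 ^ p, x2 ^ p, y1 ^ p, y2 ^ p, z1 ^ p, z2 ^ p} ∪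
  {rcomm z1 y1, rcomm z1 y2, rcomm z2 x1, rcomm z2 x2, rcomm z1 z2} ∪
  {r | ∃ i : Fin 8, ∃ w ∈ ({x1, x2, y1, y2, z1, z2} ∪ Set.range t : Set (FreeGroup Gen)),
    r = rcomm (t i) w}

/-- The group `G⋆ = ⟨x₁, x₂, y₁, y₂ ∣ …⟩`. -/
abbrev GStar (p : ℕ) : Type := PresentedGroup (relators p)

/-- The relators of
`⟨a, b ∣ [a, b] = z, [z, a] = s, [z, b] = t, aᵖ = bᵖ = zᵖ = 1⟩`, all the other commutators of
two of `a, b, z, s, t` being trivial. -/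
def factorRelators {α : Type} (p : ℕ) (a b : FreeGroup α) : Set (FreeGroup α) :=
  {a ^ p, b ^ p, rcomm a b ^ p} ∪
  {r | ∃ u ∈ ({rcomm (rcomm a b) a, rcomm (rcomm a b) b} : Set (FreeGroup α)),
    ∃ w ∈ ({a, b, rcomm a b, rcomm (rcomm a b) a, rcomm (rcomm a b) b} : Set (FreeGroup α)),
      r = rcomm u w}

/-- The generators of `H'`. -/
inductive XGen
  | x1 | x2

/-- The generators of `K'`. -/
inductive YGen
  | y1 | y2

/-- `H' = ⟨x₁, x₂ ∣ [x₁, x₂] = z₁, [z₁, x₁] = t₁, [z₁, x₂] = t₂, x₁ᵖ = x₂ᵖ = z₁ᵖ = 1⟩`. -/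
abbrev HPrime (p : ℕ) : Type :=
  PresentedGroup (factorRelators p (FreeGroup.of XGen.x1) (FreeGroup.of XGen.x2))

/-- `K' = ⟨y₁, y₂ ∣ [y₁, y₂] = z₂, [z₂, y₁] = t₃, [z₂, y₂] = t₄, y₁ᵖ = y₂ᵖ = z₂ᵖ = 1⟩`. -/
abbrev KPrime (p : ℕ) : Type :=
  PresentedGroup (factorRelators p (FreeGroup.of YGen.y1) (FreeGroup.of YGen.y2))

/-- The group `(ℤ/p)⁴`, written multiplicatively. -/
abbrev ElemAb (p : ℕ) : Type := Multiplicative (Fin 4 → ZMod p)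

end RepGroup

/-! Structure of `GStar p`. Centrality of the `tⱼ` already forces the mixed relations: if `[x, w]`
and `[y, w]` are central, then `[x, y]` commutes with `w` (`rcomm_rcomm_eq_one`). So `G⋆` is
universal for two "factor pairs" whose four cross commutators are central, and such commutators
depend bilinearly on the abelianized factors. The resulting pairing of `H'` and `K'` with values in
`(ℤ/p)⁴` defines an action, and homomorphisms in both directions identify `G⋆` with `(H' × (ℤ/p)⁴) ⋊
K'`. Collecting words into normal form bounds `|H'|` by `p ^ 5`. The explicit group `FactorModel
(ZMod p)` shows that the bound is attained, whence `|G⋆| = p ^ (5 + 4 + 5)`.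

Representation group. The kernel of `toHeisenberg` is generated by the `tⱼ`, so it is central and
consists of products of commutators. For any central extension `S → G` with kernel `A`,
transgression maps `Hom(A, ℂˣ)` to `H²(G, ℂˣ)`. It is injective when `A ≤ [S, S]`, because a
character that extends to `S` must vanish on commutators. It is surjective when `S` maps to every
central extension of `G` with divisible kernel. For finite `S` the dual of `A` is isomorphic to `A`,
so `A` is then the Schur multiplier. For `G⋆` the required map exists: divisibility lets the
generators lift to elements of order dividing `p`, and oddness of `p` forces `zᵢ ^ p = 1`
(`rcomm_pow_eq_one_of_class_three`).

Class. A central kernel over a group of class at most two gives class at most three; `t₁ ≠ 1`, seen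
in the model, excludes class two. -/

open scoped commutatorElement IsMulCommutative

/-! ### Commutator identities in groups with central commutators. -/

section Commutators

variable {G H : Type} [Group G] [Group H]

theorem map_rcomm (f : G →* H) (x y : G) : f (rcomm x y) = rcomm (f x) (f y) := by
  simp [rcomm]

theorem rcomm_eq_one_iff {x y : G} : rcomm x y = 1 ↔ Commute x y := by
  rw [rcomm, mul_assoc, mul_assoc, inv_mul_eq_one, eq_inv_mul_iff_mul_eq]
  exact eq_comm

theorem conj_eq_mul_rcomm (x y : G) : y⁻¹ * x * y = x * rcomm x y := by
  simp [rcomm, mul_assoc]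

theorem mul_eq_mul_mul_rcomm (x y : G) : x * y = y * x * rcomm x y := by
  simp [rcomm, mul_assoc]

theorem inv_rcomm (x y : G) : (rcomm x y)⁻¹ = rcomm y x := by
  simp [rcomm, mul_assoc]

theorem rcomm_eq_commutatorElement (x y : G) : rcomm x y = ⁅x⁻¹, y⁻¹⁆ := by
  simp [rcomm, commutatorElement_def]

theorem rcomm_mem_commutator (x y : G) : rcomm x y ∈ commutator G := by
  rw [rcomm_eq_commutatorElement]
  exact Subgroup.commutator_mem_commutator (Subgroup.mem_top _) (Subgroup.mem_top _)

theorem commute_of_mem_center {c : G} (hc : c ∈ Subgroup.center G) (g : G) : Commute c g :=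
  (Subgroup.mem_center_iff.1 hc g).symm

theorem rcomm_eq_one_of_mem_center {c : G} (hc : c ∈ Subgroup.center G) (g : G) :
    rcomm c g = 1 :=
  rcomm_eq_one_iff.2 (commute_of_mem_center hc g)

theorem conj_zpow_of_rcomm_mem_center {z x : G} (h : rcomm z x ∈ Subgroup.center G) (n : ℤ) :
    x⁻¹ * z ^ n * x = z ^ n * rcomm z x ^ n := by
  have h1 : x⁻¹ * z ^ n * x = (x⁻¹ * z * x) ^ n := by
    simpa using (conj_zpow (i := n) (a := x⁻¹) (b := z)).symm
  rw [h1, conj_eq_mul_rcomm, (commute_of_mem_center h z).symm.mul_zpow]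

theorem zpow_mul_of_rcomm_mem_center {z x : G} (h : rcomm z x ∈ Subgroup.center G) (n : ℤ) :
    z ^ n * x = x * z ^ n * rcomm z x ^ n := by
  rw [mul_assoc x, ← conj_zpow_of_rcomm_mem_center h]
  simp [mul_assoc]

theorem rcomm_pow_of_rcomm_mem_center {z x : G} (h : rcomm z x ∈ Subgroup.center G) (n : ℕ) :
    rcomm (z ^ n) x = rcomm z x ^ n := by
  have := conj_zpow_of_rcomm_mem_center h n
  rw [zpow_natCast, zpow_natCast, conj_eq_mul_rcomm] at this
  exact mul_left_cancel this

/-- A central commutator is multiplicative in its first entry, so it equals `[z ^ n, x]` after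
raising to the power `n`. -/
theorem rcomm_pow_eq_one {z x : G} {n : ℕ} (h : rcomm z x ∈ Subgroup.center G)
    (hz : z ^ n ∈ Subgroup.center G) : rcomm z x ^ n = 1 := by
  rw [← rcomm_pow_of_rcomm_mem_center h, rcomm_eq_one_of_mem_center hz]

/-- Moving every `z` to the right past the later copies of `x` costs one central commutator per
crossing. -/
theorem mul_pow_of_rcomm_mem_center {x z : G} (h : rcomm z x ∈ Subgroup.center G) (n : ℕ) :
    (x * z) ^ n = x ^ n * z ^ n * rcomm z x ^ (n.choose 2) := by
  have hc (k : ℕ) (g : G) : rcomm z x ^ k * g = g * rcomm z x ^ k :=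
    ((commute_of_mem_center h g).pow_left k).eq
  induction n with
  | zero => simp
  | succ n ih =>
    have h2 := zpow_mul_of_rcomm_mem_center h n
    simp only [zpow_natCast] at h2
    calc (x * z) ^ (n + 1) = x ^ n * z ^ n * (rcomm z x ^ (n.choose 2) * (x * z)) := by
          rw [pow_succ, ih, mul_assoc]
      _ = x ^ n * (z ^ n * x) * z * rcomm z x ^ (n.choose 2) := by
          rw [hc]; simp only [mul_assoc]
      _ = x ^ (n + 1) * z ^ n * (rcomm z x ^ n * z) * rcomm z x ^ (n.choose 2) := by
          rw [h2, pow_succ]; simp only [mul_assoc]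
      _ = x ^ (n + 1) * z ^ (n + 1) * rcomm z x ^ (n + n.choose 2) := by
          rw [hc, pow_succ z, pow_add (rcomm z x)]; simp only [mul_assoc]
      _ = _ := by
          rw [Nat.choose_succ_succ' n 1, Nat.choose_one_right]

/-- In a group of class three in which `x ^ p = 1`, the commutator `[x, y]` has order dividing `p`
as soon as its `p`-th power is central. -/
theorem rcomm_pow_eq_one_of_class_three {x y : G} {p : ℕ} (hp : Odd p)
    (hs : rcomm (rcomm x y) x ∈ Subgroup.center G) (hx : x ^ p = 1)
    (hz : rcomm x y ^ p ∈ Subgroup.center G) : rcomm x y ^ p = 1 := by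
  have h1 : rcomm (rcomm x y) x ^ p = 1 := rcomm_pow_eq_one hs hz
  have h2 := mul_pow_of_rcomm_mem_center hs p
  -- The only use of oddness: for `p = 2k + 1` the binomial coefficient is `p * k`.
  have h3 : rcomm (rcomm x y) x ^ (p.choose 2) = 1 := by
    obtain ⟨k, rfl⟩ := hp
    rw [Nat.choose_two_right, Nat.add_sub_cancel, mul_left_comm, Nat.mul_div_cancel_left _ two_pos,
      pow_mul, h1, one_pow]
  -- Since `x * [x, y]` is a conjugate of `x`, its `p`-th power is trivial as well, while the
  -- expansion leaves `[x, y] ^ p`.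
  rw [← conj_eq_mul_rcomm, h3, hx, one_mul, mul_one] at h2
  rw [← h2]
  have := (conj_pow (i := p) (a := y⁻¹) (b := x))
  rw [inv_inv] at this
  rw [this, hx]; simp

/-- If `[x, w]` and `[y, w]` are central then `[x, y]` commutes with `w`. -/
theorem rcomm_rcomm_eq_one {x y w : G} (hx : rcomm x w ∈ Subgroup.center G)
    (hy : rcomm y w ∈ Subgroup.center G) : rcomm (rcomm x y) w = 1 := by
  have h1 : w⁻¹ * rcomm x y * w = rcomm (w⁻¹ * x * w) (w⁻¹ * y * w) := by
    simp [rcomm, mul_assoc]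
  rw [conj_eq_mul_rcomm, conj_eq_mul_rcomm, conj_eq_mul_rcomm] at h1
  have hx' (g : G) := (commute_of_mem_center hx g).eq
  -- Conjugation by `w` multiplies `x` and `y` by central elements, which cancel in the commutator.
  have h2 : rcomm (x * rcomm x w) (y * rcomm y w) = rcomm x y := by
    generalize rcomm x w = c at *
    generalize rcomm y w = d at *
    have hd (g : G) := (commute_of_mem_center hy g).eq
    calc rcomm (x * c) (y * d) = c⁻¹ * x⁻¹ * (d⁻¹ * (y⁻¹ * x * c * y)) * d := by
          simp [rcomm, mul_assoc]
      _ = c⁻¹ * x⁻¹ * (y⁻¹ * x * (c * y)) * (d⁻¹ * d) := by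
          rw [(((commute_of_mem_center hy (y⁻¹ * x * c * y))).inv_left).eq]
          simp only [mul_assoc]
      _ = c⁻¹ * (x⁻¹ * y⁻¹ * x * y * c) := by
          rw [hx']; simp [mul_assoc]
      _ = rcomm x y := by
          rw [← hx']; simp [rcomm, mul_assoc]
  rw [h2] at h1
  simpa using h1

theorem mem_center_of_closure_eq_top {s : Set G} (hs : Subgroup.closure s = ⊤) {c : G}
    (h : ∀ g ∈ s, Commute c g) : c ∈ Subgroup.center G := by
  have h1 : Subgroup.closure s ≤ Subgroup.centralizer {c} := by
    rw [Subgroup.closure_le]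
    intro g hg
    rw [SetLike.mem_coe, Subgroup.mem_centralizer_singleton_iff]
    exact (h g hg).symm.eq
  rw [hs] at h1
  rw [Subgroup.mem_center_iff]
  intro g
  exact Subgroup.mem_centralizer_singleton_iff.1 (h1 (Subgroup.mem_top g))

theorem zpow_eq_pow_val {p : ℕ} [NeZero p] {x : G} (hx : x ^ p = 1) (n : ℤ) :
    x ^ n = x ^ (n : ZMod p).val := by
  rw [zpow_eq_zpow_emod' n hx, ← ZMod.val_intCast, zpow_natCast]

end Commutators

/-! ### Factor pairs and the collection process. -/

namespace RepGroup

/-- `x` and `y` satisfy the relations of `H'`, the triple commutators being central in the whole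
group. -/
structure IsFactorPair {G : Type} [Group G] (p : ℕ) (x y : G) : Prop where
  pow_x : x ^ p = 1
  pow_y : y ^ p = 1
  pow_z : rcomm x y ^ p = 1
  central_s : rcomm (rcomm x y) x ∈ Subgroup.center G
  central_t : rcomm (rcomm x y) y ∈ Subgroup.center G

namespace IsFactorPair

variable {G : Type} [Group G] {p : ℕ} {x y : G}

theorem pow_s (h : IsFactorPair p x y) : rcomm (rcomm x y) x ^ p = 1 :=
  rcomm_pow_eq_one h.central_s (by rw [h.pow_z]; exact Subgroup.one_mem _)

theorem pow_t (h : IsFactorPair p x y) : rcomm (rcomm x y) y ^ p = 1 :=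
  rcomm_pow_eq_one h.central_t (by rw [h.pow_z]; exact Subgroup.one_mem _)

/-- Makes the exponents of the generators into homomorphisms from `H'` and `K'`. -/
theorem of_comm {A : Type} [CommGroup A] {x y : A} (hx : x ^ p = 1) (hy : y ^ p = 1) :
    IsFactorPair p x y where
  pow_x := hx
  pow_y := hy
  pow_z := by rw [rcomm_eq_one_iff.2 (Commute.all _ _), one_pow]
  central_s := by rw [rcomm_eq_one_iff.2 (Commute.all _ _)]; exact Subgroup.one_mem _
  central_t := by rw [rcomm_eq_one_iff.2 (Commute.all _ _)]; exact Subgroup.one_mem _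

theorem lift_relators {α : Type} {a b : α} {f : α → G} (h : IsFactorPair p (f a) (f b)) :
    ∀ r ∈ factorRelators p (FreeGroup.of a) (FreeGroup.of b), FreeGroup.lift f r = 1 := by
  rintro r ((rfl | rfl | rfl) | ⟨u, rfl | rfl, w, -, rfl⟩)
  · simpa using h.pow_x
  · simpa using h.pow_y
  · simpa [map_rcomm] using h.pow_z
  · rw [map_rcomm]
    apply rcomm_eq_one_of_mem_center
    simpa [map_rcomm] using h.central_s
  · rw [map_rcomm]
    apply rcomm_eq_one_of_mem_center
    simpa [map_rcomm] using h.central_t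

/-- Every element of a group generated by a factor pair has the form
`x ^ a * y ^ b * z ^ c * s ^ d * t ^ e`. -/
theorem exists_normal_form (h : IsFactorPair p x y) (hp : p ≠ 0)
    (hxy : Subgroup.closure {x, y} = ⊤) (g : G) :
    ∃ (a c d e : ℤ) (b : ℕ), g = x ^ a * y ^ b * rcomm x y ^ c * rcomm (rcomm x y) x ^ d *
      rcomm (rcomm x y) y ^ e := by
  set z := rcomm x y with hz
  set s := rcomm z x with hs
  set t := rcomm z y with ht
  have hsc (k : ℤ) (g : G) : s ^ k * g = g * s ^ k :=
    ((commute_of_mem_center h.central_s g).zpow_left k).eq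
  have htc (k : ℤ) (g : G) : t ^ k * g = g * t ^ k :=
    ((commute_of_mem_center h.central_t g).zpow_left k).eq
  have hzx (k : ℤ) : z ^ k * x = x * z ^ k * s ^ k := zpow_mul_of_rcomm_mem_center h.central_s k
  have hzy (k : ℤ) : z ^ k * y = y * z ^ k * t ^ k := zpow_mul_of_rcomm_mem_center h.central_t k
  have hzinv : rcomm z⁻¹ y = t⁻¹ := by
    have := conj_zpow_of_rcomm_mem_center h.central_t (-1)
    rw [zpow_neg_one, zpow_neg_one, conj_eq_mul_rcomm] at this
    exact mul_left_cancel this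
  -- Conjugation by `x` turns `y` into `y * z⁻¹`, whose powers involve `b.choose 2`; this is why the
  -- exponent of `y` is kept natural.
  have hyx (b : ℕ) : y ^ b * x = x * y ^ b * z ^ (-b : ℤ) * t ^ (-(b.choose 2) : ℤ) := by
    have h1 : x⁻¹ * y ^ b * x = (x⁻¹ * y * x) ^ b := by
      simpa using (conj_pow (i := b) (a := x⁻¹) (b := y)).symm
    rw [conj_eq_mul_rcomm y, ← inv_rcomm x y, ← hz, mul_pow_of_rcomm_mem_center, hzinv] at h1
    · rw [zpow_neg, zpow_neg, zpow_natCast, zpow_natCast, mul_assoc x, mul_assoc x, ← inv_pow,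
        ← inv_pow, ← h1]
      simp [mul_assoc]
    · rw [hzinv]; exact Subgroup.inv_mem _ h.central_t
  let P : G → Prop := fun g => ∃ (a c d e : ℤ) (b : ℕ), g = x ^ a * y ^ b * z ^ c * s ^ d * t ^ e
  have hPy (g : G) (hg : P g) : P (g * y) := by
    obtain ⟨a, c, d, e, b, rfl⟩ := hg
    refine ⟨a, c, d, e + c, b + 1, ?_⟩
    calc x ^ a * y ^ b * z ^ c * s ^ d * t ^ e * y
        = x ^ a * y ^ b * (z ^ c * y) * s ^ d * t ^ e := by
          rw [mul_assoc _ (t ^ e), htc, ← mul_assoc, mul_assoc _ (s ^ d), hsc]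
          simp only [mul_assoc]
      _ = x ^ a * (y ^ b * y) * z ^ c * (t ^ c * s ^ d) * t ^ e := by
          rw [hzy]; simp only [mul_assoc]
      _ = _ := by
          rw [htc, ← pow_succ, add_comm e, zpow_add]; simp only [mul_assoc]
  have hPx (g : G) (hg : P g) : P (g * x) := by
    obtain ⟨a, c, d, e, b, rfl⟩ := hg
    refine ⟨a + 1, -b + c, c + d, -(b.choose 2) + e, b, ?_⟩
    calc x ^ a * y ^ b * z ^ c * s ^ d * t ^ e * x
        = x ^ a * y ^ b * (z ^ c * x) * s ^ d * t ^ e := by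
          rw [mul_assoc _ (t ^ e), htc, ← mul_assoc, mul_assoc _ (s ^ d), hsc]
          simp only [mul_assoc]
      _ = x ^ a * (y ^ b * x) * z ^ c * s ^ c * s ^ d * t ^ e := by
          rw [hzx]; simp only [mul_assoc]
      _ = x ^ a * x * y ^ b * z ^ (-b : ℤ) * (t ^ (-(b.choose 2) : ℤ) * (z ^ c * s ^ c * s ^ d))
            * t ^ e := by
          rw [hyx]; simp only [mul_assoc]
      _ = _ := by
          rw [htc]; simp only [zpow_add, zpow_one, mul_assoc]
  -- An inverse generator is a `(p - 1)`-st power, so closure under right multiplication by the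
  -- generators suffices.
  have hinv {w : G} (hw : w ^ p = 1) (hP : ∀ g, P g → P (g * w)) (g : G) (hg : P g) :
      P (g * w⁻¹) := by
    have h1 (n : ℕ) : P (g * w ^ n) := by
      induction n with
      | zero => simpa using hg
      | succ n ih => rw [pow_succ, ← mul_assoc]; exact hP _ ih
    have h2 : w⁻¹ = w ^ (p - 1) := by
      rw [inv_eq_iff_mul_eq_one, ← pow_succ', Nat.sub_add_cancel (Nat.one_le_iff_ne_zero.2 hp), hw]
    rw [h2]
    exact h1 _
  have hg : g ∈ Subgroup.closure {x, y} := hxy ▸ Subgroup.mem_top g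
  induction hg using Subgroup.closure_induction_right with
  | one => exact ⟨0, 0, 0, 0, 0, by simp⟩
  | mul_right u _ w hw ih =>
    rcases hw with rfl | rfl
    · exact hPx _ ih
    · exact hPy _ ih
  | mul_inv_cancel u _ w hw ih =>
    rcases hw with rfl | rfl
    · exact hinv h.pow_x hPx _ ih
    · exact hinv h.pow_y hPy _ ih

/-- All five factors of the normal form have order dividing `p`, so the exponents matter only modulo
`p`. -/
theorem card_le [NeZero p] (h : IsFactorPair p x y) (hxy : Subgroup.closure {x, y} = ⊤) :
    Finite G ∧ Nat.card G ≤ p ^ 5 := by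
  let f : ZMod p × ZMod p × ZMod p × ZMod p × ZMod p → G := fun v =>
    x ^ v.1.val * y ^ v.2.1.val * rcomm x y ^ v.2.2.1.val *
      rcomm (rcomm x y) x ^ v.2.2.2.1.val * rcomm (rcomm x y) y ^ v.2.2.2.2.val
  have hf : Function.Surjective f := by
    intro g
    obtain ⟨a, c, d, e, b, rfl⟩ := h.exists_normal_form (NeZero.ne p) hxy g
    refine ⟨(a, (b : ℤ), c, d, e), ?_⟩
    rw [← zpow_natCast y b, zpow_eq_pow_val h.pow_x, zpow_eq_pow_val h.pow_y,
      zpow_eq_pow_val h.pow_z, zpow_eq_pow_val h.pow_s, zpow_eq_pow_val h.pow_t]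
  refine ⟨Finite.of_surjective f hf, (Nat.card_le_card_of_surjective f hf).trans ?_⟩
  simp only [Nat.card_prod, Nat.card_zmod]
  exact le_of_eq (by ring)

end IsFactorPair

end RepGroup

theorem rcomm_eq_of_mul_eq {G : Type} [Group G] {x y w : G} (h : x * y = y * x * w) :
    rcomm x y = w := by
  rw [mul_eq_mul_mul_rcomm] at h
  exact mul_left_cancel h

/-! ### An explicit model of order `p ^ 5`. -/

namespace RepGroup

/-- The group of normal forms `x ^ a * y ^ b * z ^ c * s ^ d * t ^ e`, with exponents in `R`. -/
@[ext]
structure FactorModel (R : Type) where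
  a : R
  b : R
  c : R
  d : R
  e : R

namespace FactorModel

theorem card (R : Type) : Nat.card (FactorModel R) = Nat.card R ^ 5 := by
  let e : FactorModel R ≃ R × R × R × R × R :=
    ⟨fun g => (g.a, g.b, g.c, g.d, g.e), fun v => ⟨v.1, v.2.1, v.2.2.1, v.2.2.2.1, v.2.2.2.2⟩,
      fun _ => rfl, fun _ => rfl⟩
  rw [Nat.card_congr e]
  simp only [Nat.card_prod]
  ring

variable {R : Type} [CommRing R]

instance : One (FactorModel R) := ⟨⟨0, 0, 0, 0, 0⟩⟩

@[simp] theorem one_a : (1 : FactorModel R).a = 0 := rfl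
@[simp] theorem one_b : (1 : FactorModel R).b = 0 := rfl
@[simp] theorem one_c : (1 : FactorModel R).c = 0 := rfl
@[simp] theorem one_d : (1 : FactorModel R).d = 0 := rfl
@[simp] theorem one_e : (1 : FactorModel R).e = 0 := rfl

variable [Invertible (2 : R)]

/-- The binomial coefficient `r * (r - 1) / 2`. -/
def choose (r : R) : R := ⅟2 * (r * (r - 1))

theorem choose_add (r u : R) : choose (r + u) = choose r + choose u + r * u := by
  simp only [choose]
  linear_combination (r * u) * invOf_mul_self (2 : R)

@[simp] theorem choose_zero : choose (0 : R) = 0 := by simp [choose]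

@[simp] theorem choose_one : choose (1 : R) = 0 := by simp [choose]

/-- The product is read off from collection: passing `y ^ b` over `x ^ a'` produces `z ^ (-a' b)`,
`s ^ (-b * choose a')` and `t ^ (-a' * choose b)`; the powers of `z` then pass over `x ^ a'` and `y
^ b'`. Inverting `2` makes the binomials polynomial in the exponents, and `choose_add` is what
associativity needs. -/
instance : Mul (FactorModel R) :=
  ⟨fun g h => ⟨g.a + h.a, g.b + h.b, g.c + h.c - h.a * g.b, g.d + h.d + g.c * h.a - g.b * choose h.a,
    g.e + h.e - h.a * choose g.b + (g.c - h.a * g.b) * h.b⟩⟩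

instance : Inv (FactorModel R) :=
  ⟨fun h => ⟨-h.a, -h.b, -h.c - h.a * h.b, -(h.d + (-h.c - h.a * h.b) * h.a + h.b * choose h.a),
    -(h.e - h.a * choose (-h.b) - h.c * h.b)⟩⟩

@[simp] theorem mul_a (g h : FactorModel R) : (g * h).a = g.a + h.a := rfl
@[simp] theorem mul_b (g h : FactorModel R) : (g * h).b = g.b + h.b := rfl
@[simp] theorem mul_c (g h : FactorModel R) : (g * h).c = g.c + h.c - h.a * g.b := rfl
@[simp] theorem mul_d (g h : FactorModel R) :
    (g * h).d = g.d + h.d + g.c * h.a - g.b * choose h.a := rfl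
@[simp] theorem mul_e (g h : FactorModel R) :
    (g * h).e = g.e + h.e - h.a * choose g.b + (g.c - h.a * g.b) * h.b := rfl
@[simp] theorem inv_a (h : FactorModel R) : (h⁻¹).a = -h.a := rfl
@[simp] theorem inv_b (h : FactorModel R) : (h⁻¹).b = -h.b := rfl
@[simp] theorem inv_c (h : FactorModel R) : (h⁻¹).c = -h.c - h.a * h.b := rfl
@[simp] theorem inv_d (h : FactorModel R) :
    (h⁻¹).d = -(h.d + (-h.c - h.a * h.b) * h.a + h.b * choose h.a) := rfl
@[simp] theorem inv_e (h : FactorModel R) :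
    (h⁻¹).e = -(h.e - h.a * choose (-h.b) - h.c * h.b) := rfl

instance : Group (FactorModel R) :=
  Group.ofLeftAxioms
    (fun g h k => by
      ext
      · simp only [mul_a]; ring
      · simp only [mul_b]; ring
      · simp only [mul_a, mul_b, mul_c]; ring
      · simp only [mul_a, mul_b, mul_c, mul_d, choose_add]; ring
      · simp only [mul_a, mul_b, mul_c, mul_e, choose_add]; ring)
    (fun g => by ext <;> simp)
    (fun g => by
      ext
      · simp
      · simp
      · simp only [mul_c, inv_b, inv_c, one_c]; ring
      · simp only [mul_d, inv_b, inv_c, inv_d, one_d]; ring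
      · simp only [mul_e, inv_b, inv_c, inv_e, one_e]; ring)

variable (R) in
/-- The generator `x`. -/
def x : FactorModel R := ⟨1, 0, 0, 0, 0⟩

variable (R) in
/-- The generator `y`. -/
def y : FactorModel R := ⟨0, 1, 0, 0, 0⟩

theorem rcomm_x_y : rcomm (x R) (y R) = ⟨0, 0, 1, 0, 0⟩ := by
  apply rcomm_eq_of_mul_eq
  ext <;> simp [x, y]

theorem rcomm_z_x : rcomm (rcomm (x R) (y R)) (x R) = ⟨0, 0, 0, 1, 0⟩ := by
  rw [rcomm_x_y]
  apply rcomm_eq_of_mul_eq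
  ext <;> simp [x]

theorem rcomm_z_y : rcomm (rcomm (x R) (y R)) (y R) = ⟨0, 0, 0, 0, 1⟩ := by
  rw [rcomm_x_y]
  apply rcomm_eq_of_mul_eq
  ext <;> simp [y]

theorem mem_center (d e : R) : (⟨0, 0, 0, d, e⟩ : FactorModel R) ∈ Subgroup.center _ := by
  rw [Subgroup.mem_center_iff]
  intro g
  ext <;> simp [add_comm]

theorem x_pow (n : ℕ) : x R ^ n = ⟨n, 0, 0, 0, 0⟩ := by
  induction n with
  | zero => ext <;> simp
  | succ n ih => rw [pow_succ, ih]; ext <;> simp [x]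

theorem y_pow (n : ℕ) : y R ^ n = ⟨0, n, 0, 0, 0⟩ := by
  induction n with
  | zero => ext <;> simp
  | succ n ih => rw [pow_succ, ih]; ext <;> simp [y]

theorem z_pow (n : ℕ) : (⟨0, 0, 1, 0, 0⟩ : FactorModel R) ^ n = ⟨0, 0, n, 0, 0⟩ := by
  induction n with
  | zero => ext <;> simp
  | succ n ih => rw [pow_succ, ih]; ext <;> simp

theorem s_pow (n : ℕ) : (⟨0, 0, 0, 1, 0⟩ : FactorModel R) ^ n = ⟨0, 0, 0, n, 0⟩ := by
  induction n with
  | zero => ext <;> simp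
  | succ n ih => rw [pow_succ, ih]; ext <;> simp

theorem t_pow (n : ℕ) : (⟨0, 0, 0, 0, 1⟩ : FactorModel R) ^ n = ⟨0, 0, 0, 0, n⟩ := by
  induction n with
  | zero => ext <;> simp
  | succ n ih => rw [pow_succ, ih]; ext <;> simp

theorem isFactorPair (p : ℕ) [CharP R p] : IsFactorPair p (x R) (y R) where
  pow_x := by rw [x_pow, CharP.cast_eq_zero]; rfl
  pow_y := by rw [y_pow, CharP.cast_eq_zero]; rfl
  pow_z := by rw [rcomm_x_y, z_pow, CharP.cast_eq_zero]; rfl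
  central_s := by rw [rcomm_z_x]; exact mem_center _ _
  central_t := by rw [rcomm_z_y]; exact mem_center _ _

theorem normal_form (a b c d e : ℕ) : x R ^ a * y R ^ b * rcomm (x R) (y R) ^ c *
    rcomm (rcomm (x R) (y R)) (x R) ^ d * rcomm (rcomm (x R) (y R)) (y R) ^ e =
      ⟨a, b, c, d, e⟩ := by
  rw [rcomm_z_x, rcomm_z_y, rcomm_x_y, x_pow, y_pow, z_pow, s_pow, t_pow]
  ext <;> simp

end FactorModel

/-! ### The presented groups `H'` and `K'`: order and isomorphism. -/

section FactorGroup

variable {α : Type} {p : ℕ} {a b : α}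

theorem closure_factorGroup (h : ∀ i, i = a ∨ i = b) :
    Subgroup.closure {PresentedGroup.of a, PresentedGroup.of b} =
      (⊤ : Subgroup (PresentedGroup (factorRelators p (FreeGroup.of a) (FreeGroup.of b)))) := by
  rw [← PresentedGroup.closure_range_of]
  congr 1
  ext g
  constructor
  · rintro (rfl | rfl) <;> exact ⟨_, rfl⟩
  · rintro ⟨i, rfl⟩
    rcases h i with rfl | rfl
    · exact Or.inl rfl
    · exact Or.inr rfl

theorem isFactorPair_factorGroup (h : ∀ i, i = a ∨ i = b) :
    IsFactorPair p (PresentedGroup.of a : PresentedGroup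
      (factorRelators p (FreeGroup.of a) (FreeGroup.of b))) (PresentedGroup.of b) := by
  have key {r : FreeGroup α} (hr : r ∈ factorRelators p (FreeGroup.of a) (FreeGroup.of b)) :
      PresentedGroup.mk (factorRelators p (FreeGroup.of a) (FreeGroup.of b)) r = 1 :=
    PresentedGroup.one_of_mem hr
  refine ⟨?_, ?_, ?_, ?_, ?_⟩
  · exact key (Or.inl (Or.inl rfl))
  · exact key (Or.inl (Or.inr (Or.inl rfl)))
  · exact key (Or.inl (Or.inr (Or.inr rfl)))
  · refine mem_center_of_closure_eq_top (closure_factorGroup h) ?_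
    rintro g (rfl | rfl) <;> rw [← rcomm_eq_one_iff]
    · exact key (Or.inr ⟨_, Or.inl rfl, _, Or.inl rfl, rfl⟩)
    · exact key (Or.inr ⟨_, Or.inl rfl, _, Or.inr (Or.inl rfl), rfl⟩)
  · refine mem_center_of_closure_eq_top (closure_factorGroup h) ?_
    rintro g (rfl | rfl) <;> rw [← rcomm_eq_one_iff]
    · exact key (Or.inr ⟨_, Or.inr rfl, _, Or.inl rfl, rfl⟩)
    · exact key (Or.inr ⟨_, Or.inr rfl, _, Or.inr (Or.inl rfl), rfl⟩)

theorem invertible_two_zmod (hodd : Odd p) : Nonempty (Invertible (2 : ZMod p)) := by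
  have h := (ZMod.isUnit_iff_coprime 2 p).2 (Nat.coprime_two_left.2 hodd)
  exact h.nonempty_invertible

/-- A homomorphism from a group generated by a factor pair to the model that matches the
generators is surjective. -/
theorem surjective_to_factorModel {G : Type} [Group G] [NeZero p] [Invertible (2 : ZMod p)]
    {u v : G} (f : G →* FactorModel (ZMod p)) (hu : f u = FactorModel.x _)
    (hv : f v = FactorModel.y _) : Function.Surjective f := by
  rintro ⟨a, b, c, d, e⟩
  refine ⟨u ^ a.val * v ^ b.val * rcomm u v ^ c.val * rcomm (rcomm u v) u ^ d.val *
    rcomm (rcomm u v) v ^ e.val, ?_⟩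
  simp only [map_mul, map_pow, map_rcomm, hu, hv, FactorModel.normal_form, ZMod.natCast_val,
    ZMod.cast_id', id_eq]

open Classical in
theorem exists_toFactorModel [Invertible (2 : ZMod p)] (hab : a ≠ b) :
    ∃ f : PresentedGroup (factorRelators p (FreeGroup.of a) (FreeGroup.of b)) →*
      FactorModel (ZMod p), f (PresentedGroup.of a) = FactorModel.x _ ∧
        f (PresentedGroup.of b) = FactorModel.y _ := by
  let f : α → FactorModel (ZMod p) := fun i =>
    if i = a then FactorModel.x _ else FactorModel.y _
  have ha : f a = FactorModel.x _ := if_pos rfl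
  have hb : f b = FactorModel.y _ := if_neg hab.symm
  have h : IsFactorPair p (f a) (f b) := by
    rw [ha, hb]; exact FactorModel.isFactorPair p
  exact ⟨PresentedGroup.toGroup h.lift_relators, by simp [ha], by simp [hb]⟩

/-- Normal forms give the upper bound, the surjection to the model the lower one. -/
theorem card_factorGroup [NeZero p] (hodd : Odd p) (h : ∀ i, i = a ∨ i = b) (hab : a ≠ b) :
    Nat.card (PresentedGroup (factorRelators p (FreeGroup.of a) (FreeGroup.of b))) = p ^ 5 := by
  obtain ⟨_⟩ := invertible_two_zmod hodd
  obtain ⟨f, ha, hb⟩ := exists_toFactorModel (p := p) hab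
  obtain ⟨hfin, hle⟩ := (isFactorPair_factorGroup h).card_le (closure_factorGroup (p := p) h)
  refine le_antisymm hle ?_
  have := Nat.card_le_card_of_surjective f (surjective_to_factorModel f ha hb)
  rwa [FactorModel.card, Nat.card_zmod] at this

theorem rcomm_ne_one_factorGroup [NeZero p] (hp : p ≠ 1) (hodd : Odd p) (hab : a ≠ b) :
    rcomm (rcomm (PresentedGroup.of a) (PresentedGroup.of b)) (PresentedGroup.of a) ≠
      (1 : PresentedGroup (factorRelators p (FreeGroup.of a) (FreeGroup.of b))) := by
  obtain ⟨_⟩ := invertible_two_zmod hodd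
  obtain ⟨f, ha, hb⟩ := exists_toFactorModel (p := p) hab
  intro h
  have h1 := congrArg f h
  rw [map_rcomm, map_rcomm, ha, hb, FactorModel.rcomm_z_x, map_one] at h1
  have h2 : (1 : ZMod p) = 0 := congrArg FactorModel.d h1
  have : Fact (1 < p) := ⟨by have := NeZero.ne p; omega⟩
  exact one_ne_zero h2

end FactorGroup

theorem XGen.eq_or (i : XGen) : i = XGen.x1 ∨ i = XGen.x2 := by cases i <;> simp

theorem YGen.eq_or (i : YGen) : i = YGen.y1 ∨ i = YGen.y2 := by cases i <;> simp

/-- The values on the generators of a homomorphism from `H'`. -/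
def xval {G : Type} (u v : G) : XGen → G
  | .x1 => u
  | .x2 => v

/-- The values on the generators of a homomorphism from `K'`. -/
def yval {G : Type} (u v : G) : YGen → G
  | .y1 => u
  | .y2 => v

/-- The homomorphism from `H'` determined by a factor pair. -/
def HPrime.lift {G : Type} [Group G] {p : ℕ} {u v : G} (h : IsFactorPair p u v) : HPrime p →* G :=
  PresentedGroup.toGroup
    (IsFactorPair.lift_relators (f := xval u v) (a := XGen.x1) (b := XGen.x2) h)

/-- The homomorphism from `K'` determined by a factor pair. -/
def KPrime.lift {G : Type} [Group G] {p : ℕ} {u v : G} (h : IsFactorPair p u v) : KPrime p →* G :=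
  PresentedGroup.toGroup
    (IsFactorPair.lift_relators (f := yval u v) (a := YGen.y1) (b := YGen.y2) h)

section lift

variable {G : Type} [Group G] {p : ℕ} {u v : G} (h : IsFactorPair p u v)

@[simp] theorem HPrime.lift_x1 : HPrime.lift h (PresentedGroup.of XGen.x1) = u :=
  PresentedGroup.toGroup.of _

@[simp] theorem HPrime.lift_x2 : HPrime.lift h (PresentedGroup.of XGen.x2) = v :=
  PresentedGroup.toGroup.of _

@[simp] theorem KPrime.lift_y1 : KPrime.lift h (PresentedGroup.of YGen.y1) = u :=
  PresentedGroup.toGroup.of _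

@[simp] theorem KPrime.lift_y2 : KPrime.lift h (PresentedGroup.of YGen.y2) = v :=
  PresentedGroup.toGroup.of _

end lift

theorem HPrime.isFactorPair (p : ℕ) :
    IsFactorPair p (PresentedGroup.of XGen.x1 : HPrime p) (PresentedGroup.of XGen.x2) :=
  isFactorPair_factorGroup XGen.eq_or

theorem KPrime.isFactorPair (p : ℕ) :
    IsFactorPair p (PresentedGroup.of YGen.y1 : KPrime p) (PresentedGroup.of YGen.y2) :=
  isFactorPair_factorGroup YGen.eq_or

/-- The isomorphism of `H'` with `K'` that matches the generators. -/
def hPrimeEquivKPrime (p : ℕ) : HPrime p ≃* KPrime p :=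
  MonoidHom.toMulEquiv (HPrime.lift (KPrime.isFactorPair p)) (KPrime.lift (HPrime.isFactorPair p))
    (by apply PresentedGroup.ext; rintro (_ | _) <;> simp)
    (by apply PresentedGroup.ext; rintro (_ | _) <;> simp)

theorem HPrime.card {p : ℕ} [NeZero p] (hodd : Odd p) : Nat.card (HPrime p) = p ^ 5 :=
  card_factorGroup hodd XGen.eq_or (by simp)

theorem KPrime.card {p : ℕ} [NeZero p] (hodd : Odd p) : Nat.card (KPrime p) = p ^ 5 :=
  card_factorGroup hodd YGen.eq_or (by simp)

end RepGroup

/-! ### The universal property of `G⋆`. -/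

namespace RepGroup

/-- `x₁, x₂, y₁, y₂` satisfy the relations of `G⋆`, the `tⱼ` being central in the whole group. -/
structure IsStarTuple {G : Type} [Group G] (p : ℕ) (x₁ x₂ y₁ y₂ : G) : Prop where
  pairX : IsFactorPair p x₁ x₂
  pairY : IsFactorPair p y₁ y₂
  central_x1y1 : rcomm x₁ y₁ ∈ Subgroup.center G
  central_x1y2 : rcomm x₁ y₂ ∈ Subgroup.center G
  central_x2y1 : rcomm x₂ y₁ ∈ Subgroup.center G
  central_x2y2 : rcomm x₂ y₂ ∈ Subgroup.center G

/-- The values on the generators of a homomorphism from `G⋆`. -/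
def gval {G : Type} (x₁ x₂ y₁ y₂ : G) : Gen → G
  | .x1 => x₁
  | .x2 => x₂
  | .y1 => y₁
  | .y2 => y₂

section

variable {G : Type} [Group G]

theorem rcomm_mem_center_symm {x y : G} (h : rcomm x y ∈ Subgroup.center G) :
    rcomm y x ∈ Subgroup.center G := by
  rw [← inv_rcomm]; exact Subgroup.inv_mem _ h

namespace IsStarTuple

variable {p : ℕ} {x₁ x₂ y₁ y₂ : G} (h : IsStarTuple p x₁ x₂ y₁ y₂)

include h

theorem map_t (f : FreeGroup Gen →* G) (h1 : f x1 = x₁) (h2 : f x2 = x₂) (h3 : f y1 = y₁)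
    (h4 : f y2 = y₂) (i : Fin 8) : f (t i) ∈ Subgroup.center G := by
  have := h.pairX.central_s
  have := h.pairX.central_t
  have := h.pairY.central_s
  have := h.pairY.central_t
  have := h.central_x1y1
  have := h.central_x1y2
  have := h.central_x2y1
  have := h.central_x2y2
  fin_cases i <;> simpa [t, map_rcomm, h1, h2, h3, h4, z1, z2]

/-- The relations between `zᵢ` and the other pair, and `[z₁, z₂] = 1`, are consequences of the
centrality of the cross commutators, so a star tuple need not list them. -/
theorem map_relators (f : FreeGroup Gen →* G) (h1 : f x1 = x₁) (h2 : f x2 = x₂) (h3 : f y1 = y₁)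
    (h4 : f y2 = y₂) : ∀ r ∈ relators p, f r = 1 := by
  have hz1y1 : rcomm (rcomm x₁ x₂) y₁ = 1 := rcomm_rcomm_eq_one h.central_x1y1 h.central_x2y1
  have hz1y2 : rcomm (rcomm x₁ x₂) y₂ = 1 := rcomm_rcomm_eq_one h.central_x1y2 h.central_x2y2
  have hz2 {x : G} (hx1 : rcomm x y₁ ∈ Subgroup.center G) (hx2 : rcomm x y₂ ∈ Subgroup.center G) :
      rcomm (rcomm y₁ y₂) x = 1 :=
    rcomm_rcomm_eq_one (rcomm_mem_center_symm hx1) (rcomm_mem_center_symm hx2)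
  have hz1z2 : rcomm (rcomm x₁ x₂) (rcomm y₁ y₂) = 1 := by
    rw [← inv_rcomm, inv_eq_one]
    refine hz2 ?_ ?_
    · rw [hz1y1]; exact Subgroup.one_mem _
    · rw [hz1y2]; exact Subgroup.one_mem _
  rintro r (((rfl | rfl | rfl | rfl | rfl | rfl) | (rfl | rfl | rfl | rfl | rfl)) |
    ⟨i, w, -, rfl⟩)
  · rw [map_pow, h1, h.pairX.pow_x]
  · rw [map_pow, h2, h.pairX.pow_y]
  · rw [map_pow, h3, h.pairY.pow_x]
  · rw [map_pow, h4, h.pairY.pow_y]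
  · rw [map_pow, z1, map_rcomm, h1, h2, h.pairX.pow_z]
  · rw [map_pow, z2, map_rcomm, h3, h4, h.pairY.pow_z]
  · rw [map_rcomm, z1, map_rcomm, h1, h2, h3, hz1y1]
  · rw [map_rcomm, z1, map_rcomm, h1, h2, h4, hz1y2]
  · rw [map_rcomm, z2, map_rcomm, h3, h4, h1, hz2 h.central_x1y1 h.central_x1y2]
  · rw [map_rcomm, z2, map_rcomm, h3, h4, h2, hz2 h.central_x2y1 h.central_x2y2]
  · rw [map_rcomm, z1, z2, map_rcomm, map_rcomm, h1, h2, h3, h4, hz1z2]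
  · rw [map_rcomm]
    exact rcomm_eq_one_of_mem_center (h.map_t f h1 h2 h3 h4 i) _

end IsStarTuple

/-- The homomorphism from `G⋆` determined by a tuple that satisfies the relations. -/
def GStar.lift {p : ℕ} {x₁ x₂ y₁ y₂ : G} (h : IsStarTuple p x₁ x₂ y₁ y₂) : GStar p →* G :=
  PresentedGroup.toGroup (f := gval x₁ x₂ y₁ y₂) (h.map_relators _ FreeGroup.lift_apply_of
    FreeGroup.lift_apply_of FreeGroup.lift_apply_of FreeGroup.lift_apply_of)

section lift

variable {p : ℕ} {x₁ x₂ y₁ y₂ : G} (h : IsStarTuple p x₁ x₂ y₁ y₂)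

@[simp] theorem GStar.lift_x1 : GStar.lift h (PresentedGroup.of Gen.x1) = x₁ :=
  PresentedGroup.toGroup.of _

@[simp] theorem GStar.lift_x2 : GStar.lift h (PresentedGroup.of Gen.x2) = x₂ :=
  PresentedGroup.toGroup.of _

@[simp] theorem GStar.lift_y1 : GStar.lift h (PresentedGroup.of Gen.y1) = y₁ :=
  PresentedGroup.toGroup.of _

@[simp] theorem GStar.lift_y2 : GStar.lift h (PresentedGroup.of Gen.y2) = y₂ :=
  PresentedGroup.toGroup.of _

end lift

end

theorem GStar.mk_t_mem_center (p : ℕ) (i : Fin 8) :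
    PresentedGroup.mk (relators p) (t i) ∈ Subgroup.center (GStar p) := by
  refine mem_center_of_closure_eq_top (PresentedGroup.closure_range_of _) ?_
  rintro _ ⟨w, rfl⟩
  rw [← rcomm_eq_one_iff]
  refine PresentedGroup.one_of_mem (rels := relators p) (x := rcomm (t i) (FreeGroup.of w))
    (Or.inr ⟨i, _, Or.inl ?_, rfl⟩)
  cases w
  · exact Or.inl rfl
  · exact Or.inr (Or.inl rfl)
  · exact Or.inr (Or.inr (Or.inl rfl))
  · exact Or.inr (Or.inr (Or.inr (Or.inl rfl)))

theorem GStar.isStarTuple (p : ℕ) : IsStarTuple p (PresentedGroup.of Gen.x1 : GStar p)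
    (PresentedGroup.of Gen.x2) (PresentedGroup.of Gen.y1) (PresentedGroup.of Gen.y2) where
  pairX :=
    { pow_x := PresentedGroup.one_of_mem (x := x1 ^ p) (by simp [relators])
      pow_y := PresentedGroup.one_of_mem (x := x2 ^ p) (by simp [relators])
      pow_z := PresentedGroup.one_of_mem (x := z1 ^ p) (by simp [relators])
      central_s := GStar.mk_t_mem_center p 0
      central_t := GStar.mk_t_mem_center p 1 }
  pairY :=
    { pow_x := PresentedGroup.one_of_mem (x := y1 ^ p) (by simp [relators])
      pow_y := PresentedGroup.one_of_mem (x := y2 ^ p) (by simp [relators])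
      pow_z := PresentedGroup.one_of_mem (x := z2 ^ p) (by simp [relators])
      central_s := GStar.mk_t_mem_center p 2
      central_t := GStar.mk_t_mem_center p 3 }
  central_x1y1 := GStar.mk_t_mem_center p 4
  central_x1y2 := GStar.mk_t_mem_center p 5
  central_x2y1 := GStar.mk_t_mem_center p 6
  central_x2y2 := GStar.mk_t_mem_center p 7

/-! ### The bilinear pairing and the map from `G⋆` to the semidirect product. -/

section SemidirectDecomposition

variable (p : ℕ)

theorem pow_multiplicative_zmod (v : Multiplicative (ZMod p)) : v ^ p = 1 := by
  rw [← ofAdd_toAdd v, ← ofAdd_nsmul, nsmul_eq_mul, CharP.cast_eq_zero, zero_mul, ofAdd_zero]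

/-- The exponents of `x₁` and `x₂`, as a homomorphism from `H'`. -/
def xExp (u v : ZMod p) : HPrime p →* Multiplicative (ZMod p) :=
  HPrime.lift (u := Multiplicative.ofAdd u) (v := Multiplicative.ofAdd v)
    (IsFactorPair.of_comm (pow_multiplicative_zmod p _) (pow_multiplicative_zmod p _))

/-- The exponents of `y₁` and `y₂`, as a homomorphism from `K'`. -/
def yExp (u v : ZMod p) : KPrime p →* Multiplicative (ZMod p) :=
  KPrime.lift (u := Multiplicative.ofAdd u) (v := Multiplicative.ofAdd v)
    (IsFactorPair.of_comm (pow_multiplicative_zmod p _) (pow_multiplicative_zmod p _))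

/-- The commutator pairing of `H'` and `K'` in `G⋆`. -/
def pairing (h : HPrime p) (k : KPrime p) : ElemAb p :=
  Multiplicative.ofAdd
    ![(xExp p 1 0 h).toAdd * (yExp p 1 0 k).toAdd, (xExp p 1 0 h).toAdd * (yExp p 0 1 k).toAdd,
      (xExp p 0 1 h).toAdd * (yExp p 1 0 k).toAdd, (xExp p 0 1 h).toAdd * (yExp p 0 1 k).toAdd]

theorem pairing_mul_left (h h' : HPrime p) (k : KPrime p) :
    pairing p (h * h') k = pairing p h k * pairing p h' k := by
  apply Multiplicative.toAdd.injective
  ext i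
  fin_cases i <;> simp [pairing, add_mul]

theorem pairing_mul_right (h : HPrime p) (k k' : KPrime p) :
    pairing p h (k * k') = pairing p h k * pairing p h k' := by
  apply Multiplicative.toAdd.injective
  ext i
  fin_cases i <;> simp [pairing, mul_add]

@[simp] theorem pairing_one_right (h : HPrime p) : pairing p h 1 = 1 := by
  apply Multiplicative.toAdd.injective
  ext i
  fin_cases i <;> simp [pairing]

/-- The action of `K'` on `H' × (ℤ/p)⁴`. -/
def action : KPrime p →* MulAut (HPrime p × ElemAb p) where
  toFun k :=
    { toFun := fun n => (n.1, n.2 * (pairing p n.1 k)⁻¹)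
      invFun := fun n => (n.1, n.2 * pairing p n.1 k)
      left_inv := fun n => by simp
      right_inv := fun n => by simp
      map_mul' := fun n m => by
        ext1
        · rfl
        · simp only [Prod.fst_mul, Prod.snd_mul, pairing_mul_left, mul_inv]
          exact mul_mul_mul_comm _ _ _ _ }
  map_one' := by ext1 n; simp
  map_mul' k k' := by
    ext1 n
    simp [pairing_mul_right, mul_assoc]

/-- The inverse appears because the action is `n ↦ k n k⁻¹`, whereas `k⁻¹ h k = h [h, k]`; with this
sign `[h, k]` becomes the pairing itself. -/
theorem action_apply (k : KPrime p) (n : HPrime p × ElemAb p) :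
    action p k n = (n.1, n.2 * (pairing p n.1 k)⁻¹) := rfl

theorem action_symm_apply (k : KPrime p) (n : HPrime p × ElemAb p) :
    (action p k)⁻¹ n = (n.1, n.2 * pairing p n.1 k) := rfl

/-- The group `(H' × (ℤ/p)⁴) ⋊ K'`. -/
abbrev Decomposition : Type := (HPrime p × ElemAb p) ⋊[action p] KPrime p

variable {p}

theorem rcomm_inl_inr (h : HPrime p) (v : ElemAb p) (k : KPrime p) :
    rcomm (SemidirectProduct.inl (h, v) : Decomposition p) (SemidirectProduct.inr k) =
      SemidirectProduct.inl (1, pairing p h k) := by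
  have h1 : (SemidirectProduct.inr k : Decomposition p)⁻¹ * SemidirectProduct.inl (h, v) *
      SemidirectProduct.inr k = SemidirectProduct.inl ((h, v) * (1, pairing p h k)) := by
    have := SemidirectProduct.inl_aut_inv (φ := action p) k (h, v)
    rw [← map_inv, ← this, action_symm_apply]
    simp
  rw [conj_eq_mul_rcomm, map_mul] at h1
  exact mul_left_cancel h1

theorem inl_mem_center {h : HPrime p} (hh : h ∈ Subgroup.center _) (hk : ∀ k, pairing p h k = 1)
    (v : ElemAb p) :
    (SemidirectProduct.inl (h, v) : Decomposition p) ∈ Subgroup.center _ := by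
  rw [Subgroup.mem_center_iff]
  intro g
  rw [← SemidirectProduct.inl_left_mul_inr_right g]
  have h1 : Commute (SemidirectProduct.inr g.right : Decomposition p)
      (SemidirectProduct.inl (h, v)) := by
    apply Commute.symm
    rw [← rcomm_eq_one_iff, rcomm_inl_inr, hk]
    exact map_one _
  have h2 : Commute (SemidirectProduct.inl g.left : Decomposition p)
      (SemidirectProduct.inl (h, v)) := by
    refine Commute.map ?_ SemidirectProduct.inl
    exact Prod.ext (commute_of_mem_center hh _).symm.eq (mul_comm _ _)
  exact (h2.mul_left h1).eq

theorem inr_mem_center {k : KPrime p} (hk : k ∈ Subgroup.center _) (hh : ∀ h, pairing p h k = 1) :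
    (SemidirectProduct.inr k : Decomposition p) ∈ Subgroup.center _ := by
  rw [Subgroup.mem_center_iff]
  intro g
  rw [← SemidirectProduct.inl_left_mul_inr_right g]
  have h1 : Commute (SemidirectProduct.inl g.left : Decomposition p) (SemidirectProduct.inr k) := by
    rw [← rcomm_eq_one_iff, ← Prod.mk.eta (p := g.left), rcomm_inl_inr, hh]
    exact map_one _
  have h2 : Commute (SemidirectProduct.inr g.right : Decomposition p) (SemidirectProduct.inr k) :=
    Commute.map (commute_of_mem_center hk _).symm SemidirectProduct.inr
  exact (h1.mul_left h2).eq

theorem map_rcomm_comm {G A : Type} [Group G] [CommGroup A] (f : G →* A) (x y : G) :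
    f (rcomm x y) = 1 := by
  rw [map_rcomm, rcomm_eq_one_iff]; exact Commute.all _ _

theorem pairing_rcomm_left (x y : HPrime p) (k : KPrime p) : pairing p (rcomm x y) k = 1 := by
  apply Multiplicative.toAdd.injective
  ext i
  fin_cases i <;> simp [pairing, map_rcomm_comm]

theorem pairing_rcomm_right (h : HPrime p) (x y : KPrime p) : pairing p h (rcomm x y) = 1 := by
  apply Multiplicative.toAdd.injective
  ext i
  fin_cases i <;> simp [pairing, map_rcomm_comm]

theorem rcomm_inl (h h' : HPrime p) :
    rcomm (SemidirectProduct.inl (h, 1) : Decomposition p) (SemidirectProduct.inl (h', 1)) =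
      SemidirectProduct.inl (rcomm h h', 1) := by
  rw [← map_rcomm]
  congr 1
  simp [rcomm]

theorem rcomm_inr (k k' : KPrime p) :
    rcomm (SemidirectProduct.inr k : Decomposition p) (SemidirectProduct.inr k') =
      SemidirectProduct.inr (rcomm k k') := (map_rcomm _ _ _).symm

theorem one_mem_center_pairing (v : ElemAb p) :
    (SemidirectProduct.inl (1, v) : Decomposition p) ∈ Subgroup.center _ := by
  refine inl_mem_center (Subgroup.one_mem _) (fun k => ?_) v
  -- The identity is itself the commutator `[1, 1]`.
  have := pairing_rcomm_left (1 : HPrime p) 1 k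
  simpa [rcomm] using this

theorem isStarTuple_decomposition (p : ℕ) : IsStarTuple p
    (SemidirectProduct.inl (PresentedGroup.of XGen.x1, 1) : Decomposition p)
    (SemidirectProduct.inl (PresentedGroup.of XGen.x2, 1))
    (SemidirectProduct.inr (PresentedGroup.of YGen.y1))
    (SemidirectProduct.inr (PresentedGroup.of YGen.y2)) := by
  have hX := HPrime.isFactorPair p
  have hY := KPrime.isFactorPair p
  have hpow {h : HPrime p} (hh : h ^ p = 1) :
      (SemidirectProduct.inl (h, 1) : Decomposition p) ^ p = 1 := by
    rw [← map_pow, Prod.pow_mk, hh, one_pow]; exact map_one _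
  have hpow' {k : KPrime p} (hk : k ^ p = 1) :
      (SemidirectProduct.inr k : Decomposition p) ^ p = 1 := by
    rw [← map_pow, hk, map_one]
  refine ⟨⟨hpow hX.pow_x, hpow hX.pow_y, ?_, ?_, ?_⟩, ⟨hpow' hY.pow_x, hpow' hY.pow_y, ?_, ?_, ?_⟩,
    ?_, ?_, ?_, ?_⟩
  · rw [rcomm_inl]; exact hpow hX.pow_z
  · rw [rcomm_inl, rcomm_inl]
    exact inl_mem_center hX.central_s (pairing_rcomm_left _ _) _
  · rw [rcomm_inl, rcomm_inl]
    exact inl_mem_center hX.central_t (pairing_rcomm_left _ _) _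
  · rw [rcomm_inr]; exact hpow' hY.pow_z
  · rw [rcomm_inr, rcomm_inr]
    exact inr_mem_center hY.central_s fun h => pairing_rcomm_right _ _ _
  · rw [rcomm_inr, rcomm_inr]
    exact inr_mem_center hY.central_t fun h => pairing_rcomm_right _ _ _
  all_goals rw [rcomm_inl_inr]; exact one_mem_center_pairing _

/-- The homomorphism from `G⋆` to `(H' × (ℤ/p)⁴) ⋊ K'`. -/
def toDecomposition (p : ℕ) : GStar p →* Decomposition p :=
  GStar.lift (isStarTuple_decomposition p)

/-- `finProdFinEquiv` enumerates the pairs in the order of `t₅, t₆, t₇, t₈`. -/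
theorem pairing_generators (i j : Fin 2) :
    pairing p (PresentedGroup.of (![XGen.x1, XGen.x2] i)) (PresentedGroup.of (![YGen.y1, YGen.y2] j)) =
      Multiplicative.ofAdd (Pi.single (finProdFinEquiv (i, j)) 1) := by
  apply Multiplicative.toAdd.injective
  ext l
  fin_cases i <;> fin_cases j <;> fin_cases l <;> simp [pairing, xExp, yExp, finProdFinEquiv]

theorem toDecomposition_t (j : Fin 4) :
    toDecomposition p (PresentedGroup.mk (relators p) (t (Fin.natAdd 4 j))) =
      SemidirectProduct.inl (1, Multiplicative.ofAdd (Pi.single j 1)) := by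
  have key (u v : Gen) (h : HPrime p) (k : KPrime p)
      (hu : toDecomposition p (PresentedGroup.of u) = SemidirectProduct.inl (h, 1))
      (hv : toDecomposition p (PresentedGroup.of v) = SemidirectProduct.inr k) :
      toDecomposition p (PresentedGroup.mk (relators p)
        (rcomm (FreeGroup.of u) (FreeGroup.of v))) =
          SemidirectProduct.inl (1, pairing p h k) := by
    rw [map_rcomm, map_rcomm, ← rcomm_inl_inr h 1 k, ← hu, ← hv]
    rfl
  fin_cases j
  · exact (key Gen.x1 Gen.y1 _ _ (GStar.lift_x1 _) (GStar.lift_y1 _)).trans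
      (congrArg (fun v => SemidirectProduct.inl (1, v)) (pairing_generators 0 0))
  · exact (key Gen.x1 Gen.y2 _ _ (GStar.lift_x1 _) (GStar.lift_y2 _)).trans
      (congrArg (fun v => SemidirectProduct.inl (1, v)) (pairing_generators 0 1))
  · exact (key Gen.x2 Gen.y1 _ _ (GStar.lift_x2 _) (GStar.lift_y1 _)).trans
      (congrArg (fun v => SemidirectProduct.inl (1, v)) (pairing_generators 1 0))
  · exact (key Gen.x2 Gen.y2 _ _ (GStar.lift_x2 _) (GStar.lift_y2 _)).trans
      (congrArg (fun v => SemidirectProduct.inl (1, v)) (pairing_generators 1 1))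

end SemidirectDecomposition

end RepGroup

/-! ### The inverse map and the order of `G⋆`. -/

namespace RepGroup

section ElemAb

variable {p : ℕ}

theorem ElemAb.mem_of_single_mem [NeZero p] {N : Subgroup (ElemAb p)}
    (h : ∀ j, Multiplicative.ofAdd (Pi.single j 1) ∈ N) (v : ElemAb p) : v ∈ N := by
  have h1 : v = ∏ j, Multiplicative.ofAdd (Pi.single j (1 : ZMod p)) ^ (v.toAdd j).val := by
    apply Multiplicative.toAdd.injective
    rw [toAdd_prod]
    conv_lhs => rw [← Finset.univ_sum_single v.toAdd]
    refine Finset.sum_congr rfl fun j _ => ?_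
    rw [toAdd_pow, toAdd_ofAdd, ← Pi.single_smul, nsmul_eq_mul, mul_one, ZMod.natCast_val,
      ZMod.cast_id', id]
  rw [h1]
  exact Subgroup.prod_mem _ fun j _ => Subgroup.pow_mem _ (h j) _

/-- The homomorphism from `(ℤ/p)⁴` to a commutative group with prescribed values on the standard
basis. -/
def ElemAb.lift {A : Type} [CommGroup A] (c : Fin 4 → A) (hc : ∀ j, c j ^ p = 1) :
    ElemAb p →* A :=
  AddMonoidHom.toMultiplicativeLeft
    (∑ j, (ZMod.lift p ⟨zmultiplesHom (Additive A) (Additive.ofMul (c j)), by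
      simpa using congrArg Additive.ofMul (hc j)⟩).comp (Pi.evalAddMonoidHom (fun _ => ZMod p) j))

theorem ElemAb.lift_single {A : Type} [CommGroup A] (c : Fin 4 → A) (hc : ∀ j, c j ^ p = 1)
    (j : Fin 4) : ElemAb.lift c hc (Multiplicative.ofAdd (Pi.single j 1)) = c j := by
  apply Additive.ofMul.injective
  have h (i : Fin 4) (f : ZMod p →+ Additive A) :
      f ((Pi.single j 1 : Fin 4 → ZMod p) i) = if i = j then f 1 else 0 := by
    by_cases hij : i = j
    · subst hij; simp
    · simp [hij]
  simp only [lift, AddMonoidHom.toMultiplicativeLeft_apply_apply, toAdd_ofAdd,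
    AddMonoidHom.finsetSum_apply, AddMonoidHom.comp_apply, Pi.evalAddMonoidHom_apply, ofMul_toMul, h,
    Finset.sum_ite_eq', Finset.mem_univ, if_true]
  have := ZMod.lift_coe p (⟨zmultiplesHom (Additive A) (Additive.ofMul (c j)), by
      simpa using congrArg Additive.ofMul (hc j)⟩ : { f : ℤ →+ Additive A // f p = 0 }) 1
  simpa using this

end ElemAb

section InverseMap

variable (p : ℕ)

/-- The homomorphism of `H'` to `G⋆`. -/
def xIncl : HPrime p →* GStar p := HPrime.lift (GStar.isStarTuple p).pairX

/-- The homomorphism of `K'` to `G⋆`. -/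
def yIncl : KPrime p →* GStar p := KPrime.lift (GStar.isStarTuple p).pairY

theorem GStar.mk_t_pow (j : Fin 4) :
    PresentedGroup.mk (relators p) (t (Fin.natAdd 4 j)) ^ p = 1 := by
  have h := GStar.isStarTuple p
  have key {x y : GStar p} (hc : rcomm x y ∈ Subgroup.center (GStar p)) (hx : x ^ p = 1) :
      rcomm x y ^ p = 1 :=
    rcomm_pow_eq_one hc (by rw [hx]; exact Subgroup.one_mem _)
  fin_cases j
  · exact key h.central_x1y1 h.pairX.pow_x
  · exact key h.central_x1y2 h.pairX.pow_x
  · exact key h.central_x2y1 h.pairX.pow_y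
  · exact key h.central_x2y2 h.pairX.pow_y

/-- The homomorphism of `(ℤ/p)⁴` to `G⋆`. -/
def vIncl : ElemAb p →* GStar p :=
  (Subgroup.center (GStar p)).subtype.comp
    (ElemAb.lift (fun j => ⟨_, GStar.mk_t_mem_center p (Fin.natAdd 4 j)⟩)
      fun j => Subtype.ext (GStar.mk_t_pow p j))

theorem vIncl_single (j : Fin 4) :
    vIncl p (Multiplicative.ofAdd (Pi.single j 1)) =
      PresentedGroup.mk (relators p) (t (Fin.natAdd 4 j)) := by
  rw [vIncl, MonoidHom.comp_apply, ElemAb.lift_single]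
  rfl

theorem vIncl_mem_center (v : ElemAb p) : vIncl p v ∈ Subgroup.center (GStar p) := by
  rw [vIncl, MonoidHom.comp_apply]
  exact Subtype.property _

/-- The homomorphism of `H' × (ℤ/p)⁴` to `G⋆`. -/
def xvIncl : HPrime p × ElemAb p →* GStar p :=
  (xIncl p).noncommCoprod (vIncl p) fun _ v => (commute_of_mem_center (vIncl_mem_center p v) _).symm

theorem xvIncl_apply (h : HPrime p) (v : ElemAb p) :
    xvIncl p (h, v) = xIncl p h * vIncl p v := rfl

/-- The elements of `K'` whose action on `H' × (ℤ/p)⁴` becomes conjugation in `G⋆`. -/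
def compatible : Subgroup (KPrime p) where
  carrier := {k | ∀ n, xvIncl p (action p k n) = yIncl p k * xvIncl p n * (yIncl p k)⁻¹}
  one_mem' n := by simp
  mul_mem' {k k'} hk hk' n := by
    have h1 := hk (action p k' n)
    rw [hk' n] at h1
    rw [map_mul, MulAut.mul_apply, h1]
    simp [mul_assoc]
  inv_mem' {k} hk n := by
    have h1 := hk (action p k⁻¹ n)
    rw [map_inv, MulAut.apply_inv_self] at h1
    rw [map_inv, map_inv, h1]
    simp [mul_assoc]

/-- For fixed `k`, both `h ↦ h * pairing h k` and conjugation by `k⁻¹` are homomorphisms from `H'`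
to `G⋆`, so it is enough that they agree on `x₁` and `x₂`. The factor `(ℤ/p)⁴` has central image. -/
theorem mem_compatible {k : KPrime p}
    (h1 : rcomm (xIncl p (PresentedGroup.of XGen.x1)) (yIncl p k) =
      vIncl p (pairing p (PresentedGroup.of XGen.x1) k))
    (h2 : rcomm (xIncl p (PresentedGroup.of XGen.x2)) (yIncl p k) =
      vIncl p (pairing p (PresentedGroup.of XGen.x2) k)) : k ∈ compatible p := by
  have hc (v : ElemAb p) (g : GStar p) : vIncl p v * g = g * vIncl p v :=
    (commute_of_mem_center (vIncl_mem_center p v) g).eq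
  let B : HPrime p →* ElemAb p :=
    { toFun := fun h => pairing p h k
      map_one' := by
        have := pairing_mul_left p 1 1 k
        rwa [one_mul, left_eq_mul] at this
      map_mul' := fun h h' => pairing_mul_left p h h' k }
  let f : HPrime p →* GStar p :=
    (xIncl p).noncommCoprod (vIncl p) (fun _ v => (hc v _).symm) |>.comp
      ((MonoidHom.id _).prod B)
  have hf : f = (MulAut.conj (yIncl p k)⁻¹).toMonoidHom.comp (xIncl p) := by
    apply PresentedGroup.ext
    have key (h : HPrime p) (hh : rcomm (xIncl p h) (yIncl p k) = vIncl p (pairing p h k)) :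
        f h = (MulAut.conj (yIncl p k)⁻¹).toMonoidHom.comp (xIncl p) h := by
      change xIncl p h * vIncl p (pairing p h k) = (yIncl p k)⁻¹ * xIncl p h * (yIncl p k)⁻¹⁻¹
      rw [← hh, inv_inv, conj_eq_mul_rcomm]
    rintro (_ | _)
    · exact key _ h1
    · exact key _ h2
  rintro ⟨h, v⟩
  have h4 : xIncl p h * vIncl p (pairing p h k) = (yIncl p k)⁻¹ * xIncl p h * (yIncl p k)⁻¹⁻¹ :=
    DFunLike.congr_fun hf h
  rw [inv_inv] at h4
  rw [action_apply, xvIncl_apply, xvIncl_apply, map_mul, map_inv]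
  have h5 : xIncl p h = yIncl p k * (xIncl p h * vIncl p (pairing p h k)) * (yIncl p k)⁻¹ := by
    rw [h4]; group
  calc xIncl p h * (vIncl p v * (vIncl p (pairing p h k))⁻¹)
      = yIncl p k * (xIncl p h * vIncl p (pairing p h k)) * (yIncl p k)⁻¹ *
          (vIncl p v * (vIncl p (pairing p h k))⁻¹) := by rw [← h5]
    _ = yIncl p k * (xIncl p h * vIncl p (pairing p h k)) *
          (vIncl p (v * (pairing p h k)⁻¹) * (yIncl p k)⁻¹) := by
        rw [← map_inv (vIncl p), ← map_mul (vIncl p), mul_assoc _ (yIncl p k)⁻¹, hc _ (yIncl p k)⁻¹]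
    _ = yIncl p k * (xIncl p h * (vIncl p (pairing p h k * (v * (pairing p h k)⁻¹)))) *
          (yIncl p k)⁻¹ := by
        simp only [map_mul, mul_assoc]
    _ = _ := by rw [mul_comm v, mul_inv_cancel_left]

/-- As `compatible p` is a subgroup, only `y₁` and `y₂` need checking; the four resulting identities
are the definitions of `t₅, …, t₈`. -/
theorem compatible_eq_top (k : KPrime p) : k ∈ compatible p := by
  refine PresentedGroup.generated_by _ _ ?_ k
  rintro (_ | _)
  · refine mem_compatible p ?_ ?_
    · refine Eq.trans ?_ (congrArg _ (pairing_generators 0 0).symm)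
      rw [vIncl_single p (finProdFinEquiv ((0 : Fin 2), (0 : Fin 2)))]
      simp only [xIncl, yIncl, HPrime.lift_x1, KPrime.lift_y1]
      rfl
    · refine Eq.trans ?_ (congrArg _ (pairing_generators 1 0).symm)
      rw [vIncl_single p (finProdFinEquiv ((1 : Fin 2), (0 : Fin 2)))]
      simp only [xIncl, yIncl, HPrime.lift_x2, KPrime.lift_y1]
      rfl
  · refine mem_compatible p ?_ ?_
    · refine Eq.trans ?_ (congrArg _ (pairing_generators 0 1).symm)
      rw [vIncl_single p (finProdFinEquiv ((0 : Fin 2), (1 : Fin 2)))]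
      simp only [xIncl, yIncl, HPrime.lift_x1, KPrime.lift_y2]
      rfl
    · refine Eq.trans ?_ (congrArg _ (pairing_generators 1 1).symm)
      rw [vIncl_single p (finProdFinEquiv ((1 : Fin 2), (1 : Fin 2)))]
      simp only [xIncl, yIncl, HPrime.lift_x2, KPrime.lift_y2]
      rfl

/-- The homomorphism from `(H' × (ℤ/p)⁴) ⋊ K'` to `G⋆`. -/
def ofDecomposition : Decomposition p →* GStar p :=
  SemidirectProduct.lift (xvIncl p) (yIncl p) fun k => by
    apply MonoidHom.ext
    exact compatible_eq_top p k

/-- This composite gives injectivity of `toDecomposition`; surjectivity is checked on generators, so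
the other composite is not needed. -/
theorem ofDecomposition_toDecomposition :
    (ofDecomposition p).comp (toDecomposition p) = MonoidHom.id _ := by
  apply PresentedGroup.ext
  rintro (_ | _ | _ | _) <;>
    simp [ofDecomposition, toDecomposition, xvIncl_apply, xIncl, yIncl]

theorem GStar.eq_incl_mul_incl (g : GStar p) :
    ∃ h v k, g = xIncl p h * vIncl p v * yIncl p k := by
  refine ⟨(toDecomposition p g).left.1, (toDecomposition p g).left.2, (toDecomposition p g).right,
    ?_⟩
  exact (DFunLike.congr_fun (ofDecomposition_toDecomposition p) g).symm

variable [NeZero p]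

theorem toDecomposition_surjective : Function.Surjective (toDecomposition p) := by
  have hX (h : HPrime p) :
      SemidirectProduct.inl (h, 1) ∈ (toDecomposition p).range := by
    refine PresentedGroup.generated_by _ ((toDecomposition p).range.comap
      (SemidirectProduct.inl.comp (MonoidHom.inl _ _))) ?_ h
    rintro (_ | _)
    · exact ⟨_, GStar.lift_x1 _⟩
    · exact ⟨_, GStar.lift_x2 _⟩
  have hY (k : KPrime p) : SemidirectProduct.inr k ∈ (toDecomposition p).range := by
    refine PresentedGroup.generated_by _ ((toDecomposition p).range.comap
      SemidirectProduct.inr) ?_ k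
    rintro (_ | _)
    · exact ⟨_, GStar.lift_y1 _⟩
    · exact ⟨_, GStar.lift_y2 _⟩
  have hV (v : ElemAb p) : SemidirectProduct.inl (1, v) ∈ (toDecomposition p).range :=
    ElemAb.mem_of_single_mem (N := (toDecomposition p).range.comap
      (SemidirectProduct.inl.comp (MonoidHom.inr (HPrime p) (ElemAb p))))
      (fun j => ⟨_, toDecomposition_t j⟩) v
  intro g
  have h1 : g = SemidirectProduct.inl (g.left.1, 1) * SemidirectProduct.inl (1, g.left.2) *
      SemidirectProduct.inr g.right := by
    conv_lhs => rw [← SemidirectProduct.inl_left_mul_inr_right g]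
    rw [← map_mul]; simp
  rw [← MonoidHom.mem_range, h1]
  exact Subgroup.mul_mem _ (Subgroup.mul_mem _ (hX _) (hV _)) (hY _)

/-- The decomposition of `G⋆` as a semidirect product. -/
noncomputable def decompositionEquiv : GStar p ≃* Decomposition p :=
  MulEquiv.ofBijective (toDecomposition p)
    ⟨Function.LeftInverse.injective (g := ofDecomposition p)
      (DFunLike.congr_fun (ofDecomposition_toDecomposition p)), toDecomposition_surjective p⟩

theorem GStar.card (hodd : Odd p) : Nat.card (GStar p) = p ^ 14 := by
  rw [Nat.card_congr (decompositionEquiv p).toEquiv, SemidirectProduct.card, Nat.card_prod,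
    HPrime.card hodd, KPrime.card hodd, Nat.card_congr Multiplicative.toAdd, Nat.card_fun,
    Nat.card_zmod, Nat.card_fin]
  ring

end InverseMap

end RepGroup

/-! ### Commutators and nilpotency of the Heisenberg group. -/

namespace HeisenbergGroup

variable {R : Type} [CommRing R]

theorem rcomm_eq (g h : HeisenbergGroup R) : rcomm g h = ⟨g.a * h.b - h.a * g.b, 0, 0⟩ := by
  apply rcomm_eq_of_mul_eq
  ext
  · simp only [mul_c, mul_a]; ring
  · simp [add_comm]
  · simp [add_comm]

theorem mem_center (c : R) : (⟨c, 0, 0⟩ : HeisenbergGroup R) ∈ Subgroup.center _ := by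
  rw [Subgroup.mem_center_iff]
  intro g
  ext <;> simp [add_comm]

theorem a_zpow (r : R) (n : ℤ) : (⟨0, 0, r⟩ : HeisenbergGroup R) ^ n = ⟨0, 0, n * r⟩ := by
  induction n using Int.induction_on with
  | zero => ext <;> simp
  | succ n ih => rw [zpow_add_one, ih]; ext <;> simp [add_mul]
  | pred n ih => rw [zpow_sub_one, ih]; ext <;> simp [add_mul, sub_eq_add_neg]

theorem b_zpow (r : R) (n : ℤ) : (⟨0, r, 0⟩ : HeisenbergGroup R) ^ n = ⟨0, n * r, 0⟩ := by
  induction n using Int.induction_on with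
  | zero => ext <;> simp
  | succ n ih => rw [zpow_add_one, ih]; ext <;> simp [add_mul]
  | pred n ih => rw [zpow_sub_one, ih]; ext <;> simp [add_mul, sub_eq_add_neg]

theorem c_zpow (r : R) (n : ℤ) : (⟨r, 0, 0⟩ : HeisenbergGroup R) ^ n = ⟨n * r, 0, 0⟩ := by
  induction n using Int.induction_on with
  | zero => ext <;> simp
  | succ n ih => rw [zpow_add_one, ih]; ext <;> simp [add_mul]
  | pred n ih => rw [zpow_sub_one, ih]; ext <;> simp [add_mul, sub_eq_add_neg]

theorem isFactorPair {p : ℕ} (hp : (p : R) = 0) (r u : R) :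
    RepGroup.IsFactorPair p (⟨0, 0, r⟩ : HeisenbergGroup R) ⟨0, u, 0⟩ where
  pow_x := by rw [← zpow_natCast, a_zpow, Int.cast_natCast, hp, zero_mul]; rfl
  pow_y := by rw [← zpow_natCast, b_zpow, Int.cast_natCast, hp, zero_mul]; rfl
  pow_z := by rw [rcomm_eq, ← zpow_natCast, c_zpow, Int.cast_natCast, hp, zero_mul]; rfl
  central_s := by rw [rcomm_eq]; exact mem_center _
  central_t := by rw [rcomm_eq]; exact mem_center _

variable (R) in
/-- The projection of the Heisenberg group to its abelianization. -/
def toAb : HeisenbergGroup R →* Multiplicative (R × R) where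
  toFun g := Multiplicative.ofAdd (g.b, g.a)
  map_one' := rfl
  map_mul' _ _ := rfl

theorem ker_toAb_le_center : (toAb R).ker ≤ Subgroup.center _ := by
  intro g hg
  have h1 : (g.b, g.a) = (0, 0) := Multiplicative.ofAdd.injective hg
  have h2 : g = ⟨g.c, 0, 0⟩ := by
    ext
    · rfl
    · exact congrArg Prod.fst h1
    · exact congrArg Prod.snd h1
  rw [h2]
  exact mem_center _

instance : Group.IsNilpotent (HeisenbergGroup R) :=
  Subgroup.isNilpotent_of_ker_le_center (toAb R) ker_toAb_le_center

theorem nilpotencyClass_le_two : Group.nilpotencyClass (HeisenbergGroup R) ≤ 2 :=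
  (Group.nilpotencyClass_le_of_ker_le_center (toAb R) ker_toAb_le_center).trans
    (Nat.succ_le_succ CommGroup.nilpotencyClass_le_one)

end HeisenbergGroup

/-! ### The stem extension of the Heisenberg group by `G⋆`, and the class of `G⋆`. -/

namespace RepGroup

variable (p : ℕ)

theorem heisenberg_isStarTuple : IsStarTuple p
    (⟨0, 0, (1, 0)⟩ : HeisenbergGroup (ZMod p × ZMod p)) ⟨0, (1, 0), 0⟩ ⟨0, 0, (0, 1)⟩
    ⟨0, (0, 1), 0⟩ := by
  have hp : (p : ZMod p × ZMod p) = 0 := by ext <;> simp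
  refine ⟨HeisenbergGroup.isFactorPair hp _ _, HeisenbergGroup.isFactorPair hp _ _,
    ?_, ?_, ?_, ?_⟩ <;>
  · rw [HeisenbergGroup.rcomm_eq]
    exact HeisenbergGroup.mem_center _

/-- The projection of `G⋆` to the Heisenberg group. -/
def toHeisenberg : GStar p →* HeisenbergGroup (ZMod p × ZMod p) :=
  GStar.lift (heisenberg_isStarTuple p)

theorem toHeisenberg_surjective [NeZero p] : Function.Surjective (toHeisenberg p) := by
  have hA (r : ZMod p × ZMod p) :
      (⟨0, 0, r⟩ : HeisenbergGroup (ZMod p × ZMod p)) ∈ (toHeisenberg p).range := by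
    have h : (⟨0, 0, r⟩ : HeisenbergGroup (ZMod p × ZMod p)) =
        ⟨0, 0, (1, 0)⟩ ^ (r.1.val : ℤ) * ⟨0, 0, (0, 1)⟩ ^ (r.2.val : ℤ) := by
      rw [HeisenbergGroup.a_zpow, HeisenbergGroup.a_zpow]
      ext <;> simp
    rw [h]
    exact Subgroup.mul_mem _
      (Subgroup.zpow_mem _ (MonoidHom.mem_range.2 ⟨_, GStar.lift_x1 _⟩) _)
      (Subgroup.zpow_mem _ (MonoidHom.mem_range.2 ⟨_, GStar.lift_y1 _⟩) _)
  have hB (r : ZMod p × ZMod p) :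
      (⟨0, r, 0⟩ : HeisenbergGroup (ZMod p × ZMod p)) ∈ (toHeisenberg p).range := by
    have h : (⟨0, r, 0⟩ : HeisenbergGroup (ZMod p × ZMod p)) =
        ⟨0, (1, 0), 0⟩ ^ (r.1.val : ℤ) * ⟨0, (0, 1), 0⟩ ^ (r.2.val : ℤ) := by
      rw [HeisenbergGroup.b_zpow, HeisenbergGroup.b_zpow]
      ext <;> simp
    rw [h]
    exact Subgroup.mul_mem _
      (Subgroup.zpow_mem _ (MonoidHom.mem_range.2 ⟨_, GStar.lift_x2 _⟩) _)
      (Subgroup.zpow_mem _ (MonoidHom.mem_range.2 ⟨_, GStar.lift_y2 _⟩) _)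
  have hC (r : ZMod p × ZMod p) :
      (⟨r, 0, 0⟩ : HeisenbergGroup (ZMod p × ZMod p)) ∈ (toHeisenberg p).range := by
    -- The commutator of `⟨0, 0, r⟩` and `⟨0, 1, 0⟩` is `⟨r * 1, 0, 0⟩`.
    obtain ⟨u, hu⟩ := hA r
    obtain ⟨v, hv⟩ := hB 1
    refine ⟨rcomm u v, ?_⟩
    rw [map_rcomm, hu, hv, HeisenbergGroup.rcomm_eq]
    simp
  intro g
  have h : g = ⟨g.c, 0, 0⟩ * ⟨0, g.b, 0⟩ * ⟨0, 0, g.a⟩ := by ext <;> simp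
  rw [← MonoidHom.mem_range, h]
  exact Subgroup.mul_mem _ (Subgroup.mul_mem _ (hC _) (hB _)) (hA _)

/-- Write an element as `h * v * k` with `h` and `k` in normal form. Its Heisenberg coordinates
determine the exponents of `xᵢ, yᵢ, zᵢ` modulo `p`, so on the kernel only powers of the `tⱼ`
survive. -/
theorem ker_toHeisenberg_le [NeZero p] :
    (toHeisenberg p).ker ≤ Subgroup.center (GStar p) ⊓ commutator (GStar p) := by
  have hS := GStar.isStarTuple p
  let T : Subgroup (GStar p) :=
    Subgroup.center (GStar p) ⊓ commutator (GStar p) ⊓ (toHeisenberg p).ker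
  have hmap {u v : GStar p} (h : rcomm (toHeisenberg p u) (toHeisenberg p v) = 1)
      (hc : rcomm u v ∈ Subgroup.center (GStar p)) :
      rcomm u v ∈ T :=
    ⟨⟨hc, rcomm_mem_commutator _ _⟩, MonoidHom.mem_ker.2 (by rw [map_rcomm, h])⟩
  have hs (u v w : GStar p) (hc : rcomm (rcomm u v) w ∈ Subgroup.center (GStar p)) :
      rcomm (rcomm u v) w ∈ T := by
    refine hmap ?_ hc
    rw [map_rcomm, HeisenbergGroup.rcomm_eq (toHeisenberg p u)]
    exact rcomm_eq_one_of_mem_center (HeisenbergGroup.mem_center _) _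
  have hV (v : ElemAb p) : vIncl p v ∈ T := by
    refine ElemAb.mem_of_single_mem (N := T.comap (vIncl p)) (fun j => ?_) v
    rw [Subgroup.mem_comap, vIncl_single]
    fin_cases j
    · refine hmap ?_ hS.central_x1y1
      simp only [toHeisenberg, GStar.lift_x1, GStar.lift_y1, HeisenbergGroup.rcomm_eq]
      ext <;> simp
    · refine hmap ?_ hS.central_x1y2
      simp only [toHeisenberg, GStar.lift_x1, GStar.lift_y2, HeisenbergGroup.rcomm_eq]
      ext <;> simp
    · refine hmap ?_ hS.central_x2y1
      simp only [toHeisenberg, GStar.lift_x2, GStar.lift_y1, HeisenbergGroup.rcomm_eq]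
      ext <;> simp
    · refine hmap ?_ hS.central_x2y2
      simp only [toHeisenberg, GStar.lift_x2, GStar.lift_y2, HeisenbergGroup.rcomm_eq]
      ext <;> simp
  -- the `H'`- and `K'`-parts of an element of the kernel are products of triple commutators
  have hpart {u v w : GStar p} (hu : IsFactorPair p u v) {a c d e : ℤ} {b : ℕ}
      (hw : w = u ^ a * v ^ b * rcomm u v ^ c * rcomm (rcomm u v) u ^ d * rcomm (rcomm u v) v ^ e)
      (ha : (a : ZMod p) = 0) (hb : (b : ZMod p) = 0) (hc : (c : ZMod p) = 0) :
      w ∈ T := by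
    have hb' : v ^ b = 1 := by
      rw [← zpow_natCast, zpow_eq_pow_val hu.pow_y, Int.cast_natCast, hb, ZMod.val_zero, pow_zero]
    rw [hw, zpow_eq_pow_val hu.pow_x a, zpow_eq_pow_val hu.pow_z c, ha, hb', hc, ZMod.val_zero,
      pow_zero, pow_zero, one_mul, one_mul, one_mul]
    exact Subgroup.mul_mem _ (Subgroup.zpow_mem _ (hs _ _ _ hu.central_s) _)
      (Subgroup.zpow_mem _ (hs _ _ _ hu.central_t) _)
  have himage {u v w : GStar p} (hu : IsFactorPair p u v) {a c d e : ℤ} {b : ℕ}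
      (hw : w = u ^ a * v ^ b * rcomm u v ^ c * rcomm (rcomm u v) u ^ d * rcomm (rcomm u v) v ^ e) :
      toHeisenberg p w = toHeisenberg p u ^ a * toHeisenberg p v ^ (b : ℤ) *
        rcomm (toHeisenberg p u) (toHeisenberg p v) ^ c := by
    have h1 := MonoidHom.mem_ker.1 (hs u v u hu.central_s).2
    have h2 := MonoidHom.mem_ker.1 (hs u v v hu.central_t).2
    rw [hw, map_mul, map_mul, map_zpow _ _ d, map_zpow _ _ e, h1, h2]
    simp [map_rcomm]
  intro g hg
  obtain ⟨h, v, k, rfl⟩ := GStar.eq_incl_mul_incl p g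
  obtain ⟨a, c, d, e, b, hh⟩ := (HPrime.isFactorPair p).exists_normal_form (NeZero.ne p)
    (closure_factorGroup XGen.eq_or) h
  obtain ⟨a', c', d', e', b', hk⟩ := (KPrime.isFactorPair p).exists_normal_form (NeZero.ne p)
    (closure_factorGroup YGen.eq_or) k
  replace hh := congrArg (xIncl p) hh
  replace hk := congrArg (yIncl p) hk
  simp only [map_mul, map_zpow, map_pow, map_rcomm] at hh hk
  rw [xIncl, HPrime.lift_x1, HPrime.lift_x2, ← xIncl] at hh
  rw [yIncl, KPrime.lift_y1, KPrime.lift_y2, ← yIncl] at hk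
  rw [MonoidHom.mem_ker, map_mul, map_mul, (MonoidHom.mem_ker.1 (hV v).2), mul_one,
    himage hS.pairX hh, himage hS.pairY hk] at hg
  simp only [toHeisenberg, GStar.lift_x1, GStar.lift_x2, GStar.lift_y1, GStar.lift_y2,
    HeisenbergGroup.rcomm_eq, HeisenbergGroup.a_zpow, HeisenbergGroup.b_zpow,
    HeisenbergGroup.c_zpow] at hg
  have hga := congrArg HeisenbergGroup.a hg
  have hgb := congrArg HeisenbergGroup.b hg
  have hgc := congrArg HeisenbergGroup.c hg
  simp [Prod.ext_iff] at hga hgb hgc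
  -- The `c`-coordinate also contains products of the other exponents; once these vanish it isolates
  -- the exponents of `z₁` and `z₂`.
  rw [hga.1, hga.2, hgb.1, hgb.2] at hgc
  simp at hgc
  exact (Subgroup.mul_mem _ (Subgroup.mul_mem _ (hpart hS.pairX hh hga.1 hgb.1 hgc.1) (hV v))
    (hpart hS.pairY hk hga.2 hgb.2 hgc.2)).1

theorem GStar.exists_nilpotencyClass_eq_three [NeZero p] (hp : p ≠ 1) (hodd : Odd p) :
    ∃ _ : Group.IsNilpotent (GStar p), Group.nilpotencyClass (GStar p) = 3 := by
  have hker := (ker_toHeisenberg_le p).trans inf_le_left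
  have hnil : Group.IsNilpotent (GStar p) := Subgroup.isNilpotent_of_ker_le_center _ hker
  refine ⟨hnil, le_antisymm ((Group.nilpotencyClass_le_of_ker_le_center _ hker).trans
    (Nat.succ_le_succ HeisenbergGroup.nilpotencyClass_le_two)) ?_⟩
  by_contra hlt
  -- Indexing starts at zero, so term `2` is the subgroup of triple commutators; its vanishing would
  -- kill `t₁`.
  have h2 := Subgroup.lowerCentralSeries_eq_bot_iff_nilpotencyClass_le.2
    (Nat.le_of_lt_succ (not_le.1 hlt))
  have h3 (u v : GStar p) : rcomm (rcomm u v) u = 1 := by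
    have : rcomm (rcomm u v) u ∈ (⊤ : Subgroup (GStar p)).lowerCentralSeries 2 := by
      rw [rcomm_eq_commutatorElement (rcomm u v)]
      exact Subgroup.commutator_mem_commutator (Subgroup.inv_mem _ (rcomm_mem_commutator u v))
        (Subgroup.mem_top _)
    rwa [h2, Subgroup.mem_bot] at this
  have h4 := congrArg (toDecomposition p)
    (h3 (PresentedGroup.of Gen.x1) (PresentedGroup.of Gen.x2))
  rw [map_rcomm, map_rcomm, toDecomposition, GStar.lift_x1, GStar.lift_x2, rcomm_inl, rcomm_inl,
    map_one, ← map_one SemidirectProduct.inl] at h4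
  exact rcomm_ne_one_factorGroup hp hodd (by simp)
    (congrArg Prod.fst (SemidirectProduct.inl_injective h4))

end RepGroup

/-! ### Central extensions from 2-cocycles. -/

section CocycleExtension

/-- The central extension of `G` by `A` defined by the 2-cocycle `β`. -/
@[ext]
structure CocycleExtension {G A : Type} [Group G] [CommGroup A] (β : G × G → A)
    (hβ : ∀ g h j, β (g * h, j) * β (g, h) = β (h, j) * β (g, h * j)) where
  fst : A
  snd : G

namespace CocycleExtension

variable {G A : Type} [Group G] [CommGroup A] {β : G × G → A}
  {hβ : ∀ g h j, β (g * h, j) * β (g, h) = β (h, j) * β (g, h * j)}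

instance : Mul (CocycleExtension β hβ) :=
  ⟨fun x y => ⟨x.fst * y.fst * β (x.snd, y.snd), x.snd * y.snd⟩⟩

/-- The cocycle is not assumed normalized; hence the correction by `β (1, 1)` here, in the inverse
and in `incl`. -/
instance : One (CocycleExtension β hβ) := ⟨⟨(β (1, 1))⁻¹, 1⟩⟩

instance : Inv (CocycleExtension β hβ) :=
  ⟨fun x => ⟨x.fst⁻¹ * (β (x.snd⁻¹, x.snd))⁻¹ * (β (1, 1))⁻¹, x.snd⁻¹⟩⟩

@[simp] theorem mul_fst (x y : CocycleExtension β hβ) :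
    (x * y).fst = x.fst * y.fst * β (x.snd, y.snd) := rfl
@[simp] theorem mul_snd (x y : CocycleExtension β hβ) : (x * y).snd = x.snd * y.snd := rfl
@[simp] theorem one_fst : (1 : CocycleExtension β hβ).fst = (β (1, 1))⁻¹ := rfl
@[simp] theorem one_snd : (1 : CocycleExtension β hβ).snd = 1 := rfl
@[simp] theorem inv_fst (x : CocycleExtension β hβ) :
    (x⁻¹).fst = x.fst⁻¹ * (β (x.snd⁻¹, x.snd))⁻¹ * (β (1, 1))⁻¹ := rfl
@[simp] theorem inv_snd (x : CocycleExtension β hβ) : (x⁻¹).snd = x.snd⁻¹ := rfl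

include hβ in
theorem map_one_left (g : G) : β (1, g) = β (1, 1) := by
  have := hβ 1 1 g
  rw [one_mul, one_mul] at this
  exact (mul_left_cancel this).symm

include hβ in
theorem map_one_right (g : G) : β (g, 1) = β (1, 1) := by
  have := hβ g 1 1
  rw [mul_one, mul_one] at this
  exact mul_right_cancel this

instance : Group (CocycleExtension β hβ) :=
  Group.ofLeftAxioms
    (fun x y z => by
      ext
      · have := hβ x.snd y.snd z.snd
        simp only [mul_fst, mul_snd]
        calc _ = x.fst * y.fst * z.fst * (β (x.snd * y.snd, z.snd) * β (x.snd, y.snd)) := by ac_rfl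
          _ = _ := by rw [this]; ac_rfl
      · exact mul_assoc _ _ _)
    (fun x => by ext <;> simp [map_one_left (hβ := hβ)])
    (fun x => by
      ext
      · simp only [mul_fst, inv_fst, inv_snd, one_fst]
        calc _ = (β (1, 1))⁻¹ * (x.fst⁻¹ * x.fst) * ((β (x.snd⁻¹, x.snd))⁻¹ *
              β (x.snd⁻¹, x.snd)) := by ac_rfl
          _ = _ := by simp
      · simp)

variable (hβ) in
/-- The projection of the extension to `G`. -/
def proj : CocycleExtension β hβ →* G where
  toFun := snd
  map_one' := rfl
  map_mul' _ _ := rfl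

theorem proj_surjective : Function.Surjective (proj hβ) := fun g => ⟨⟨1, g⟩, rfl⟩

variable (hβ) in
/-- The inclusion of `A` into the extension. -/
def incl : A →* CocycleExtension β hβ where
  toFun a := ⟨a * (β (1, 1))⁻¹, 1⟩
  map_one' := by ext <;> simp
  map_mul' a b := by
    ext
    · simp only [mul_fst]
      calc _ = a * (β (1, 1))⁻¹ * b := by ac_rfl
        _ = _ := by simp [mul_assoc]
    · simp

theorem mem_ker_proj {x : CocycleExtension β hβ} (hx : x ∈ (proj hβ).ker) :
    x = incl hβ (x.fst * β (1, 1)) := by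
  ext
  · simp [incl]
  · exact hx

theorem incl_mem_ker (a : A) : incl hβ a ∈ (proj hβ).ker := rfl

theorem ker_proj_le_center : (proj hβ).ker ≤ Subgroup.center _ := by
  intro x hx
  rw [Subgroup.mem_center_iff]
  intro y
  rw [mem_ker_proj hx]
  ext
  · simp only [mul_fst, incl, MonoidHom.coe_mk, OneHom.coe_mk, map_one_left (hβ := hβ),
      map_one_right (hβ := hβ)]
    ac_rfl
  · simp [incl]

end CocycleExtension

end CocycleExtension

/-! ### Transgression and the Schur multiplier. -/

section Transgression

open groupCohomology

variable {G S : Type} [Group G] [Group S] (π : S →* G) (hπ : Function.Surjective π)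

/-- The factor set of a group extension, with respect to a set-theoretic section. -/
noncomputable def factorSet (x : G × G) : π.ker :=
  ⟨Function.surjInv hπ x.1 * Function.surjInv hπ x.2 * (Function.surjInv hπ (x.1 * x.2))⁻¹, by
    simp [MonoidHom.mem_ker, Function.surjInv_eq]⟩

theorem factorSet_spec (g h : G) : Function.surjInv hπ g * Function.surjInv hπ h =
    factorSet π hπ (g, h) * Function.surjInv hπ (g * h) := by
  simp [factorSet]

variable (hc : π.ker ≤ Subgroup.center S)

include hc in
theorem factorSet_cocycle (g h j : G) : factorSet π hπ (g * h, j) * factorSet π hπ (g, h) =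
    factorSet π hπ (h, j) * factorSet π hπ (g, h * j) := by
  have hcomm (a : π.ker) (x : S) : (a : S) * x = x * a := (commute_of_mem_center (hc a.2) x).eq
  apply Subtype.ext
  apply mul_right_cancel (b := Function.surjInv hπ (g * h * j))
  simp only [Subgroup.coe_mul]
  calc _ = factorSet π hπ (g, h) *
        (factorSet π hπ (g * h, j) * Function.surjInv hπ (g * h * j)) := by
        rw [hcomm]; simp only [mul_assoc]
    _ = (factorSet π hπ (g, h) * Function.surjInv hπ (g * h)) * Function.surjInv hπ j := by
        rw [← factorSet_spec]; simp only [mul_assoc]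
    _ = Function.surjInv hπ g * (factorSet π hπ (h, j) * Function.surjInv hπ (h * j)) := by
        rw [← factorSet_spec, ← factorSet_spec]; simp only [mul_assoc]
    _ = factorSet π hπ (h, j) * (Function.surjInv hπ g * Function.surjInv hπ (h * j)) := by
        rw [← mul_assoc, ← hcomm]; simp only [mul_assoc]
    _ = _ := by
        rw [factorSet_spec]; simp only [mul_assoc]

/-- The 2-cocycle of the push-out of a central extension along a character of its kernel. -/
noncomputable def transgressionCocycle (χ : π.ker →* ℂˣ) :
    cocycles₂ (Rep.trivial ℤ G (Additive ℂˣ)) :=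
  ⟨fun x => Additive.ofMul (χ (factorSet π hπ x)), (mem_cocycles₂_iff _).2 fun g h j => by
    have := congrArg (fun a => Additive.ofMul (χ a)) (factorSet_cocycle π hπ hc g h j)
    simp only [map_mul, ofMul_mul] at this
    exact this⟩

/-- The transgression `Hom(ker π, ℂˣ) → H²(G, ℂˣ)` of a central extension. -/
noncomputable def transgression : Additive (π.ker →* ℂˣ) →+ SchurMultiplier G where
  toFun χ := H2π _ (transgressionCocycle π hπ hc χ.toMul)
  map_zero' := by
    rw [← map_zero (H2π (Rep.trivial ℤ G (Additive ℂˣ))).hom]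
    rfl
  map_add' χ ψ := by
    rw [← map_add (H2π (Rep.trivial ℤ G (Additive ℂˣ))).hom]
    rfl

/-- If the push-out cocycle along `χ` is the coboundary of `φ`, then `χ` extends to the character `x
↦ χ (x s(πx)⁻¹) φ (πx)` of `S`, where `s` is the section. Characters into `ℂˣ` kill commutators, so
`χ` is trivial on the kernel. -/
theorem transgression_injective (hcomm : π.ker ≤ commutator S) :
    Function.Injective (transgression π hπ hc) := by
  rw [injective_iff_map_eq_zero]
  intro χ hχ
  obtain ⟨φ', hφ⟩ := (H2π_eq_zero_iff _).1 hχ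
  let φ : G → ℂˣ := fun g => Additive.toMul (α := ℂˣ) (φ' g)
  replace hφ (g h : G) : χ.toMul (factorSet π hπ (g, h)) = φ h / φ (g * h) * φ g :=
    (congrFun hφ (g, h)).symm
  have hmem (x : S) : x * (Function.surjInv hπ (π x))⁻¹ ∈ π.ker := by
    simp [MonoidHom.mem_ker, Function.surjInv_eq]
  have hcent (a : π.ker) (x : S) : (a : S) * x = x * a := (commute_of_mem_center (hc a.2) x).eq
  let ψ : S →* ℂˣ := MonoidHom.mk'
    (fun x => χ.toMul ⟨_, hmem x⟩ * φ (π x)) (by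
      intro x y
      have h1 : (⟨_, hmem (x * y)⟩ : π.ker) =
          ⟨_, hmem x⟩ * ⟨_, hmem y⟩ * factorSet π hπ (π x, π y) := by
        apply Subtype.ext
        have h2 := hcent ⟨_, hmem y⟩ (Function.surjInv hπ (π x))
        simp only [factorSet, Subgroup.coe_mul, map_mul] at h2 ⊢
        calc _ = x * (Function.surjInv hπ (π x))⁻¹ * (Function.surjInv hπ (π x) *
              (y * (Function.surjInv hπ (π y))⁻¹)) * Function.surjInv hπ (π y) *
              (Function.surjInv hπ (π x * π y))⁻¹ := by simp [mul_assoc]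
          _ = _ := by rw [← h2]; simp only [mul_assoc]
      rw [h1, map_mul, map_mul, hφ, map_mul π]
      generalize φ (π x * π y) = c
      generalize φ (π x) = a
      generalize φ (π y) = b
      rw [mul_assoc (χ.toMul _ * χ.toMul _), mul_assoc (b / c), mul_comm a c, ← mul_assoc (b / c),
        div_mul_cancel]
      ac_rfl)
  apply Additive.toMul.injective
  ext1 a
  have h1 : ψ a = 1 := Abelianization.commutator_subset_ker ψ (hcomm a.2)
  have h2 : ψ a = χ.toMul a := by
    have ha : π a = 1 := a.2
    -- The section need not send `1` to `1`: `factorSet (1, 1)` is the section's value at `1`, and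
    -- `φ 1` is its image under `χ`.
    have h3 : (⟨_, hmem a⟩ : π.ker) * factorSet π hπ (1, 1) = a := by
      apply Subtype.ext
      simp [factorSet, ha]
    have h4 := hφ 1 1
    rw [mul_one, div_self', one_mul] at h4
    change χ.toMul ⟨_, hmem a⟩ * φ (π a) = _
    rw [congrArg φ ha, ← h4, ← map_mul, h3]
  rw [← h2, h1]
  rfl

/-- The extension defined by a cocycle has kernel `ℂˣ`, which is divisible, so it receives a map `ψ`
from `S` over `G`. The restriction of `ψ` to the kernel of `π` is a character that transgresses to
the given class. -/
theorem transgression_surjective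
    (hlift : ∀ (E : Type) [Group E] (q : E →* G), Function.Surjective q →
      q.ker ≤ Subgroup.center E → (∀ n : ℕ, n ≠ 0 → ∀ z ∈ q.ker, ∃ w ∈ q.ker, w ^ n = z) →
      ∃ ψ : S →* E, q.comp ψ = π) :
    Function.Surjective (transgression π hπ hc) := by
  intro x
  induction x using H2_induction_on with
  | h β =>
  let b : G × G → ℂˣ := fun x => Additive.toMul (α := ℂˣ) (β x)
  have hb (g h j : G) : b (g * h, j) * b (g, h) = b (h, j) * b (g, h * j) :=
    (mem_cocycles₂_iff _).1 β.2 g h j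
  obtain ⟨ψ, hψ⟩ := hlift (CocycleExtension b hb) (CocycleExtension.proj hb)
    CocycleExtension.proj_surjective CocycleExtension.ker_proj_le_center (by
      intro n hn z hz
      obtain ⟨w, hw⟩ : ∃ w : ℂˣ, w ^ n = z.fst * b (1, 1) := by
        obtain ⟨w, hw⟩ := IsAlgClosed.exists_pow_nat_eq ((z.fst * b (1, 1) : ℂˣ) : ℂ)
          (Nat.pos_of_ne_zero hn)
        have hw0 : w ≠ 0 := by
          rintro rfl
          rw [zero_pow hn] at hw
          exact (Units.ne_zero _) hw.symm
        exact ⟨Units.mk0 w hw0, Units.ext (by simpa using hw)⟩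
      exact ⟨CocycleExtension.incl hb w, CocycleExtension.incl_mem_ker w, by
        rw [← map_pow, hw, ← CocycleExtension.mem_ker_proj hz]⟩)
  have hsnd (x : S) : (ψ x).snd = π x := DFunLike.congr_fun hψ x
  let χ : π.ker →* ℂˣ := MonoidHom.mk' (fun a => (ψ a).fst * b (1, 1)) (by
    intro x y
    have hx : π x = 1 := x.2
    have hy : π y = 1 := y.2
    rw [Subgroup.coe_mul, map_mul, CocycleExtension.mul_fst, hsnd, hsnd, hx, hy]
    ac_rfl)
  refine ⟨Additive.ofMul χ, ?_⟩
  -- The cochain compares two sections of the cocycle extension: the image under `ψ` of the section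
  -- to `S`, and the tautological one.
  refine (H2π_eq_iff _ _).2 ⟨fun g => Additive.ofMul (ψ (Function.surjInv hπ g)).fst, ?_⟩
  ext1 ⟨g, h⟩
  have h1 := congrArg (fun x => (ψ x).fst) (factorSet_spec π hπ g h)
  have h2 : π (factorSet π hπ (g, h)) = 1 := (factorSet π hπ (g, h)).2
  simp only [map_mul, CocycleExtension.mul_fst, hsnd, h2, Function.surjInv_eq,
    CocycleExtension.map_one_left (hβ := hb)] at h1
  have h3 : (ψ (Function.surjInv hπ h)).fst / (ψ (Function.surjInv hπ (g * h))).fst *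
      (ψ (Function.surjInv hπ g)).fst = χ (factorSet π hπ (g, h)) / b (g, h) := by
    change _ = (ψ (factorSet π hπ (g, h))).fst * b (1, 1) / b (g, h)
    rw [div_mul_eq_mul_div, div_eq_div_iff_mul_eq_mul]
    calc _ = (ψ (Function.surjInv hπ g)).fst * (ψ (Function.surjInv hπ h)).fst * b (g, h) := by
          ac_rfl
      _ = _ := by rw [h1]; ac_rfl
  exact h3

include hπ hc in
/-- A finite stem extension of `G` that maps to every central extension of `G` with divisible
kernel is a representation group of `G`. -/
theorem isRepresentationGroup_of_lift [Finite S] (hcomm : π.ker ≤ commutator S)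
    (hlift : ∀ (E : Type) [Group E] (q : E →* G), Function.Surjective q →
      q.ker ≤ Subgroup.center E → (∀ n : ℕ, n ≠ 0 → ∀ z ∈ q.ker, ∃ w ∈ q.ker, w ^ n = z) →
      ∃ ψ : S →* E, q.comp ψ = π) :
    IsRepresentationGroup G S := by
  refine ⟨π, hπ, le_inf hc hcomm, ?_⟩
  have : IsMulCommutative π.ker :=
    ⟨⟨fun a b => Subtype.ext (commute_of_mem_center (hc a.2) b).eq⟩⟩
  have : NeZero (Monoid.exponent π.ker : ℂ) :=
    ⟨Nat.cast_ne_zero.2 Monoid.exponent_ne_zero_of_finite⟩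
  -- A finite abelian group is non-canonically isomorphic to its character group.
  obtain ⟨e⟩ := CommGroup.monoidHom_mulEquiv_of_hasEnoughRootsOfUnity π.ker ℂ
  exact ⟨(MulEquiv.toAdditive e.symm).trans (AddEquiv.ofBijective (transgression π hπ hc)
    ⟨transgression_injective π hπ hc hcomm, transgression_surjective π hπ hc hlift⟩)⟩

end Transgression

/-! ### Lifting `G⋆` to central extensions of the Heisenberg group. -/

namespace RepGroup

/-- Every central extension of the Heisenberg group with divisible kernel receives a map from
`G⋆`. -/
theorem GStar.exists_lift {p : ℕ} (hp : p ≠ 0) (hodd : Odd p) (E : Type) [Group E]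
    (q : E →* HeisenbergGroup (ZMod p × ZMod p)) (hq : Function.Surjective q)
    (hc : q.ker ≤ Subgroup.center E)
    (hdiv : ∀ n : ℕ, n ≠ 0 → ∀ z ∈ q.ker, ∃ w ∈ q.ker, w ^ n = z) :
    ∃ ψ : GStar p →* E, q.comp ψ = toHeisenberg p := by
  have hT := heisenberg_isStarTuple p
  -- Any lift `u` has `u ^ p` in the divisible central kernel; dividing `u` by a `p`-th root taken
  -- there makes its `p`-th power trivial.
  have hroot {g : HeisenbergGroup (ZMod p × ZMod p)} (hg : g ^ p = 1) :
      ∃ u, q u = g ∧ u ^ p = 1 := by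
    obtain ⟨u, hu⟩ := hq g
    obtain ⟨w, hw, hwu⟩ := hdiv p hp (u ^ p) (by rw [MonoidHom.mem_ker, map_pow, hu, hg])
    refine ⟨u * w⁻¹, by rw [map_mul, map_inv, hu, MonoidHom.mem_ker.1 hw, inv_one, mul_one], ?_⟩
    rw [(commute_of_mem_center (hc hw) u).symm.inv_right.mul_pow, inv_pow, hwu, mul_inv_cancel]
  have hcent {u : E} (hu : q u = 1) : u ∈ Subgroup.center E := hc hu
  -- The relation `z ^ p = 1` cannot be arranged by choosing lifts; it follows from `u ^ p = 1`
  -- because `p` is odd.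
  have hrc {u v : E} (hpow : u ^ p = 1) (hpow' : v ^ p = 1)
      (h : IsFactorPair p (q u) (q v))
      (hz : ∀ g, rcomm (rcomm (q u) (q v)) g = 1) : IsFactorPair p u v := by
    have hs : rcomm (rcomm u v) u ∈ Subgroup.center E := hcent (by rw [map_rcomm, map_rcomm, hz])
    have ht : rcomm (rcomm u v) v ∈ Subgroup.center E := hcent (by rw [map_rcomm, map_rcomm, hz])
    exact ⟨hpow, hpow', rcomm_pow_eq_one_of_class_three hodd hs hpow
      (hcent (by rw [map_pow, map_rcomm, h.pow_z])), hs, ht⟩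
  have hz (a b g : HeisenbergGroup (ZMod p × ZMod p)) : rcomm (rcomm a b) g = 1 := by
    rw [HeisenbergGroup.rcomm_eq a b]
    exact rcomm_eq_one_of_mem_center (HeisenbergGroup.mem_center _) _
  obtain ⟨u₁, hu₁, hu₁p⟩ := hroot hT.pairX.pow_x
  obtain ⟨u₂, hu₂, hu₂p⟩ := hroot hT.pairX.pow_y
  obtain ⟨v₁, hv₁, hv₁p⟩ := hroot hT.pairY.pow_x
  obtain ⟨v₂, hv₂, hv₂p⟩ := hroot hT.pairY.pow_y
  have hE : IsStarTuple p u₁ u₂ v₁ v₂ := by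
    refine ⟨hrc hu₁p hu₂p ?_ (hz _ _), hrc hv₁p hv₂p ?_ (hz _ _), hcent ?_, hcent ?_, hcent ?_,
      hcent ?_⟩
    · rw [hu₁, hu₂]; exact hT.pairX
    · rw [hv₁, hv₂]; exact hT.pairY
    · rw [map_rcomm, hu₁, hv₁, HeisenbergGroup.rcomm_eq]; ext <;> simp
    · rw [map_rcomm, hu₁, hv₂, HeisenbergGroup.rcomm_eq]; ext <;> simp
    · rw [map_rcomm, hu₂, hv₁, HeisenbergGroup.rcomm_eq]; ext <;> simp
    · rw [map_rcomm, hu₂, hv₂, HeisenbergGroup.rcomm_eq]; ext <;> simp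
  refine ⟨GStar.lift hE, ?_⟩
  apply PresentedGroup.ext
  rintro (_ | _ | _ | _)
  · simp [toHeisenberg, hu₁]
  · simp [toHeisenberg, hu₂]
  · simp [toHeisenberg, hv₁]
  · simp [toHeisenberg, hv₂]

theorem GStar.isRepresentationGroup {p : ℕ} [NeZero p] (hodd : Odd p) :
    IsRepresentationGroup (HeisenbergGroup (ZMod p × ZMod p)) (GStar p) := by
  have : Finite (GStar p) := Nat.finite_of_card_ne_zero (by
    rw [GStar.card p hodd]; exact pow_ne_zero _ (NeZero.ne p))
  have hker := ker_toHeisenberg_le p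
  exact isRepresentationGroup_of_lift (toHeisenberg p) (toHeisenberg_surjective p)
    (hker.trans inf_le_left) (hker.trans inf_le_right)
    (GStar.exists_lift (NeZero.ne p) hodd)

end RepGroup

theorem mainTheorem8 (p : ℕ) (hp : p.Prime) (hodd : Odd p) :
    Nat.card (RepGroup.GStar p) = p ^ 14 ∧
    (∃ _ : Group.IsNilpotent (RepGroup.GStar p), Group.nilpotencyClass (RepGroup.GStar p) = 3) ∧
    IsRepresentationGroup (HeisenbergGroup (ZMod p × ZMod p)) (RepGroup.GStar p) ∧
    Nat.card (RepGroup.HPrime p) = p ^ 5 ∧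
    Nat.card (RepGroup.KPrime p) = p ^ 5 ∧
    Nonempty (RepGroup.HPrime p ≃* RepGroup.KPrime p) ∧
    ∃ (φ : RepGroup.KPrime p →* MulAut (RepGroup.HPrime p × RepGroup.ElemAb p))
      (e : RepGroup.GStar p ≃* (RepGroup.HPrime p × RepGroup.ElemAb p) ⋊[φ] RepGroup.KPrime p),
      e (PresentedGroup.of RepGroup.Gen.x1) =
        SemidirectProduct.inl (PresentedGroup.of RepGroup.XGen.x1, 1) ∧
      e (PresentedGroup.of RepGroup.Gen.x2) =
        SemidirectProduct.inl (PresentedGroup.of RepGroup.XGen.x2, 1) ∧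
      e (PresentedGroup.of RepGroup.Gen.y1) =
        SemidirectProduct.inr (PresentedGroup.of RepGroup.YGen.y1) ∧
      e (PresentedGroup.of RepGroup.Gen.y2) =
        SemidirectProduct.inr (PresentedGroup.of RepGroup.YGen.y2) ∧
      (∀ j : Fin 4, e (PresentedGroup.mk (RepGroup.relators p) (RepGroup.t (Fin.natAdd 4 j))) =
        SemidirectProduct.inl (1, Multiplicative.ofAdd (Pi.single j 1))) := by
  have : NeZero p := ⟨hp.ne_zero⟩
  have hstar := RepGroup.isStarTuple_decomposition p
  exact ⟨RepGroup.GStar.card p hodd, RepGroup.GStar.exists_nilpotencyClass_eq_three p hp.ne_one hodd,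
    RepGroup.GStar.isRepresentationGroup hodd, RepGroup.HPrime.card hodd, RepGroup.KPrime.card hodd,
    ⟨RepGroup.hPrimeEquivKPrime p⟩, RepGroup.action p, RepGroup.decompositionEquiv p,
    RepGroup.GStar.lift_x1 hstar, RepGroup.GStar.lift_x2 hstar, RepGroup.GStar.lift_y1 hstar,
    RepGroup.GStar.lift_y2 hstar, RepGroup.toDecomposition_t⟩
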